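/- Identify $\mathbb{R}^2$ with $\mathbb{C}$, and let $G$ be the group of rigid motions $\sigma(z)=e^{i\alpha}z+b$ ($\alpha\in\mathbb{R}$, $b\in\mathbb{C}$) of the plane, with its Haar measure $d\alpha\,db$. Let $B_r$ denote the disc of radius $r$ centered at the origin, and let $J_1$ be the Bessel function of the first kind of order $1$. Let $f:\mathbb{C}\to\mathbb{C}$ be in $L^1_{loc}(\mathbb{R}^2)$ and let $r_1,r_2>0$. For each $r>0$ the contour integral $\int_{\partial\sigma(B_r)}f\,dz$ exists for almost every $\sigma\in G$. Suppose that, both for $r=r_1$ and for $r=r_2$, $$\int_{\partial\sigma(B_r)} f\,dz=0\qquad\text{for almost every }\sigma\in G$$ (this holds in particular if the integral exists and vanishes for every $\sigma\in G$). If $r_1/r_2$ is not of the form $s/t$ with $s,t>0$ and $J_1(s)=J_1(t)=0$, then $f$ is an entire function, that is, $f$ coincides almost everywhere with a function that is holomorphic on all of $\mathbb{C}$. -/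

import Mathlib

open MeasureTheory

noncomputable section

/-- The Bessel function of the first kind of integer order `n`, by Bessel's integral
`J_n(x) = (1/π) ∫₀^π cos (n τ - x sin τ) dτ`. -/
def besselJ (n : ℕ) (x : ℝ) : ℝ :=
  (1 / Real.pi) * ∫ τ in (0 : ℝ)..Real.pi, Real.cos (n * τ - x * Real.sin τ)

/-- The rigid motion of the plane `ℂ = ℝ²` that rotates by the angle `α` about the origin and then
translates by `b`. Every orientation-preserving isometry of the plane has this form. -/
def rigidMotion (α : ℝ) (b : ℂ) (z : ℂ) : ℂ :=
  Complex.exp (α * Complex.I) * z + b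

/-- The contour integral `∫_{∂σ(B_r)} f dz` over the boundary of the image under `σ` of the disc
`B_r` of radius `r` centred at the origin, parametrized by `θ ↦ σ (r e^{iθ})`, `0 ≤ θ ≤ 2π`. -/
def contourIntegral (f : ℂ → ℂ) (σ : ℂ → ℂ) (r : ℝ) : ℂ :=
  ∫ θ in (0 : ℝ)..(2 * Real.pi),
    f (σ (circleMap 0 r θ)) * deriv (fun t : ℝ => σ (circleMap 0 r t)) θ

/-- `∫_{∂σ(B_r)} f dz = 0` for almost every rigid motion `σ`. The group of rigid motions is
parametrized by the angle and the translation, and Lebesgue measure in these parameters is its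
Haar measure. For a locally integrable `f` and `r > 0` the integral exists for almost every `σ`, and
altering `f` on a null set alters it only for a null set of `σ`, so that this is a condition on
the class of `f` in `L¹_loc`; it holds whenever the integral vanishes for every `σ`. -/
def ContourIntegralsVanish (f : ℂ → ℂ) (r : ℝ) : Prop :=
  ∀ᵐ p : ℝ × ℂ, contourIntegral f (rigidMotion p.1 p.2) r = 0

end

/-! ### Compact symmetric integral operators on `L²` -/

section SpectralTheory

open Filter Topology

/-! Convolution with a test function reduces everything to smooth `f` whose contour integrals vanish
over every circle of radius `r₁` or `r₂`; one must show `dbar f = 0`. Here `dz ∘ dbar` is the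
Laplacian `Δ`.

Fix a centre `x` and let `Y(t)` be the contour integral over the circle of squared radius `t`,
divided by `i`. Then `Y(0) = 0`, `Y'(0) = π * dbar f x`, and `4tY''` is the same quantity formed
from `Δf`. With `R = r₁²` also `Y(R) = 0`, for every centre. So let `ψ` solve `tψ'' = -μψ` with
`ψ(0) = ψ(R) = 0`, and pair `Y` with `ψ/t`, getting a function `w` of the centre. Green's formula,
whose boundary terms vanish, gives `Δw = -4μw` (`radialSuperposition_dz_dbar`). By Fubini, `w` still
has zero contour integrals over circles of radius `r₂`.

For such a `w`, the contour integrals about a fixed centre solve the same singular equation, and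
solutions vanishing at `0` are unique up to a factor (`IsStringSolution.mul_eq_mul`). Comparison
with a plane wave identifies them as multiples of `√t J₁(2√(μt))`. Thus `ψ(R) = 0` with `ψ ≠ 0` says
that `2√μ r₁` is a zero of `J₁`; by hypothesis `2√μ r₂` is not one, so the vanishing at `r₂` forces
`dbar w = 0`, and then `w = 0` because `μ ≠ 0`.

Hence `Y/√t` is orthogonal in `L²(0, R)` to all `ψ/√t`. These are complete, since the inverse of the
Dirichlet problem is a compact symmetric operator (`eq_zero_of_orthogonal_eigenfunctions`). So `Y =
0` on `(0, R)`, and its slope at `0` gives `dbar f x = 0`.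

To return to a locally integrable `f`, let `ρ` be a radial bump. Entire functions reproduce under
`ρ` up to the factor `κ = ∫ ρ`, so `g ⋆ (ρ ⋆ f) = ρ ⋆ (g ⋆ f) = κ (g ⋆ f)`. Letting `g` run through
an approximate identity gives `f = κ⁻¹ (ρ ⋆ f)` almost everywhere. -/

theorem isCompactOperator_of_summable_norm_sq {H ι : Type*} [NormedAddCommGroup H]
    [InnerProductSpace ℝ H] [CompleteSpace H] (T : H →L[ℝ] H) (b : HilbertBasis ι ℝ H)
    (h : Summable fun i => ‖T (b i)‖ ^ 2) : IsCompactOperator T := by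
  classical
  -- Finite-rank truncations along the basis; by Cauchy–Schwarz and Bessel their distance to `T` in
  -- operator norm is at most the square root of the tail of the series.
  let F : Finset ι → H →L[ℝ] H := fun s => ∑ i ∈ s, (innerSL ℝ (b i)).smulRight (T (b i))
  have hF : ∀ s, F s ∈ compactOperator (RingHom.id ℝ) H H := fun s =>
    Submodule.sum_mem _ fun i _ => by
      have : IsCompactOperator (innerSL ℝ (b i)) :=
        isCompactOperator_of_locallyCompactSpace_dom (innerSL ℝ (b i))
      exact this.clm_comp (ContinuousLinearMap.toSpanSingleton ℝ (T (b i)))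
  refine isCompactOperator_of_tendsto (l := atTop) (F := F) ?_ (Eventually.of_forall hF)
  rw [Metric.tendsto_atTop]
  intro ε hε
  obtain ⟨s₀, hs₀⟩ := summable_iff_vanishing.1 h (Metric.ball 0 ((ε / 2) ^ 2))
    (Metric.ball_mem_nhds _ (by positivity))
  refine ⟨s₀, fun s hs => ?_⟩
  rw [dist_comm, dist_eq_norm]
  refine lt_of_le_of_lt (ContinuousLinearMap.opNorm_le_bound _ (by positivity : 0 ≤ ε / 2)
    fun x => ?_) (half_lt_self hε)
  have hx : HasSum (fun i => inner ℝ (b i) x • T (b i)) (T x) := by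
    simpa [b.repr_apply_apply] using (b.hasSum_repr x).mapL T
  have hlim : Tendsto (fun t => ∑ i ∈ t, inner ℝ (b i) x • T (b i) - F s x) atTop
      (𝓝 ((T - F s) x)) := by
    simpa using Tendsto.sub_const (show Tendsto _ _ _ from hx) (F s x)
  refine le_of_tendsto hlim.norm ?_
  filter_upwards [eventually_ge_atTop s] with t ht
  have : ∑ i ∈ t, inner ℝ (b i) x • T (b i) - F s x
      = ∑ i ∈ t \ s, inner ℝ (b i) x • T (b i) := by
    simp [F, ← Finset.sum_sdiff ht]
  rw [this]
  have h1 : ∑ i ∈ t \ s, |inner ℝ (b i) x| ^ 2 ≤ ‖x‖ ^ 2 := by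
    simpa using b.orthonormal.sum_inner_products_le x (s := t \ s)
  have h2 : ∑ i ∈ t \ s, ‖T (b i)‖ ^ 2 ≤ (ε / 2) ^ 2 := by
    have := hs₀ (t \ s) (Finset.disjoint_of_subset_right hs Finset.sdiff_disjoint)
    rw [mem_ball_zero_iff] at this
    exact (le_abs_self _).trans this.le
  calc ‖∑ i ∈ t \ s, inner ℝ (b i) x • T (b i)‖
      ≤ ∑ i ∈ t \ s, |inner ℝ (b i) x| * ‖T (b i)‖ := by
        refine (norm_sum_le _ _).trans (le_of_eq ?_)
        simp [norm_smul]
    _ ≤ √(∑ i ∈ t \ s, |inner ℝ (b i) x| ^ 2) * √(∑ i ∈ t \ s, ‖T (b i)‖ ^ 2) :=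
        Real.sum_mul_le_sqrt_mul_sqrt _ _ _
    _ ≤ ‖x‖ * (ε / 2) := by
        gcongr
        · exact Real.sqrt_le_iff.2 ⟨norm_nonneg _, h1⟩
        · exact Real.sqrt_le_iff.2 ⟨by positivity, h2⟩
    _ = ε / 2 * ‖x‖ := mul_comm _ _

/-- A bounded measurable symmetric kernel on a finite measure space defines a compact symmetric
operator on `L²`. -/
theorem exists_kernelOperator {α : Type*} [MeasurableSpace α] (μ : Measure α) [IsFiniteMeasure μ]
    {k : α → α → ℝ} (hk : Measurable (Function.uncurry k)) {C : ℝ} (hC : ∀ t s, |k t s| ≤ C)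
    (hsymm : ∀ t s, k t s = k s t) :
    ∃ T : Lp ℝ 2 μ →L[ℝ] Lp ℝ 2 μ, (∀ φ : Lp ℝ 2 μ, T φ =ᵐ[μ] fun t => ∫ s, k t s * φ s ∂μ) ∧
      IsCompactOperator T ∧ T.IsSymmetric := by
  have hkt : ∀ t, Measurable (k t) := fun t => hk.comp measurable_prodMk_left
  have hkL : ∀ t, MemLp (k t) 2 μ := fun t =>
    MemLp.of_bound (hkt t).aestronglyMeasurable C (Eventually.of_forall (hC t))
  set κ : α → Lp ℝ 2 μ := fun t => (hkL t).toLp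
  have hκ : ∀ t (φ : Lp ℝ 2 μ), inner ℝ (κ t) φ = ∫ s, k t s * φ s ∂μ := by
    intro t φ
    rw [L2.inner_def]
    refine integral_congr_ae ?_
    filter_upwards [(hkL t).coeFn_toLp] with s hs
    simp [κ, hs, mul_comm]
  obtain ⟨D, hD0, hD⟩ : ∃ D : ℝ, 0 ≤ D ∧ ∀ t, ‖κ t‖ ≤ D := by
    refine ⟨_, ?_, fun t => Lp.norm_le_of_ae_bound (C := |C|) (abs_nonneg _) ?_⟩
    · positivity
    · filter_upwards [(hkL t).coeFn_toLp] with s hs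
      rw [hs]
      exact (hC t s).trans (le_abs_self _)
  have hmeas : ∀ φ : Lp ℝ 2 μ, StronglyMeasurable fun t => ∫ s, k t s * φ s ∂μ := fun φ =>
    (hk.stronglyMeasurable.mul
      ((Lp.stronglyMeasurable φ).comp_measurable measurable_snd)).integral_prod_right
  have hbd : ∀ (φ : Lp ℝ 2 μ) t, ‖∫ s, k t s * φ s ∂μ‖ ≤ D * ‖φ‖ := fun φ t => by
    rw [← hκ]
    exact (norm_inner_le_norm _ _).trans (by gcongr; exact hD t)
  have hL : ∀ φ : Lp ℝ 2 μ, MemLp (fun t => ∫ s, k t s * φ s ∂μ) 2 μ := fun φ =>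
    MemLp.of_bound (hmeas φ).aestronglyMeasurable _ (Eventually.of_forall (hbd φ))
  let T₀ : Lp ℝ 2 μ →ₗ[ℝ] Lp ℝ 2 μ :=
    { toFun := fun φ => (hL φ).toLp
      map_add' := fun φ ψ => by
        rw [← MemLp.toLp_add]
        refine MemLp.toLp_congr _ _ (Eventually.of_forall fun t => ?_)
        simp only [Pi.add_apply, ← hκ, inner_add_right]
      map_smul' := fun c φ => by
        rw [RingHom.id_apply, ← MemLp.toLp_const_smul]
        refine MemLp.toLp_congr _ _ (Eventually.of_forall fun t => ?_)
        simp only [Pi.smul_apply, ← hκ, inner_smul_right, smul_eq_mul] }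
  set m : ℝ := (μ.real Set.univ) ^ ((2 : ENNReal).toReal)⁻¹
  have hTb : ∀ φ, ‖T₀ φ‖ ≤ (m * D) * ‖φ‖ := fun φ => by
    refine (Lp.norm_le_of_ae_bound (C := D * ‖φ‖) (by positivity) ?_).trans
      (le_of_eq (mul_assoc _ _ _).symm)
    filter_upwards [(hL φ).coeFn_toLp] with s hs
    simp only [T₀, LinearMap.coe_mk, AddHom.coe_mk, hs]
    exact hbd φ s
  let T := T₀.mkContinuous (m * D) hTb
  have hT : ∀ φ : Lp ℝ 2 μ, T φ =ᵐ[μ] fun t => ∫ s, k t s * φ s ∂μ := fun φ => (hL φ).coeFn_toLp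
  refine ⟨T, hT, ?_, ?_⟩
  -- Hilbert–Schmidt bound: Bessel's inequality for each row `κ t`, of norm at most `D`, is
  -- integrated over `t`.
  · obtain ⟨w, b, -⟩ := exists_hilbertBasis ℝ (Lp ℝ 2 μ)
    refine isCompactOperator_of_summable_norm_sq T b
      (summable_of_sum_le (c := μ.real Set.univ * D ^ 2) (fun _ => by positivity) fun s => ?_)
    have h1 : ∀ i, ‖T (b i)‖ ^ 2 = ∫ t, (inner ℝ (κ t) (b i)) ^ 2 ∂μ := fun i => by
      rw [← real_inner_self_eq_norm_sq, L2.inner_def]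
      refine integral_congr_ae ?_
      filter_upwards [hT (b i)] with t ht
      rw [ht, hκ]
      simp [sq]
    have h2 : ∀ i, Integrable (fun t => (inner ℝ (κ t) (b i)) ^ 2) μ := fun i => by
      simp only [hκ]
      exact (hL (b i)).integrable_sq
    simp only [h1]
    rw [← integral_finsetSum _ fun i _ => h2 i]
    calc ∫ t, ∑ i ∈ s, (inner ℝ (κ t) (b i)) ^ 2 ∂μ ≤ ∫ t, D ^ 2 ∂μ := by
          refine integral_mono (integrable_finsetSum _ fun i _ => h2 i) (integrable_const _)
            fun t => ?_
          have := b.orthonormal.sum_inner_products_le (κ t) (s := s)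
          simp only [real_inner_comm (κ t), Real.norm_eq_abs, sq_abs] at this
          exact this.trans (by gcongr; exact hD t)
      _ = μ.real Set.univ * D ^ 2 := by simp
  · intro φ ψ
    have hφ : Integrable φ μ := (Lp.memLp φ).integrable (by norm_num)
    have hψ : Integrable ψ μ := (Lp.memLp ψ).integrable (by norm_num)
    have e1 : inner ℝ (T φ) ψ = ∫ t, ∫ s, k t s * (φ s * ψ t) ∂μ ∂μ := by
      rw [L2.inner_def]
      refine integral_congr_ae ?_
      filter_upwards [hT φ] with t ht
      rw [ht]
      simp only [← mul_assoc]
      rw [integral_mul_const]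
      simp [mul_comm]
    have e2 : inner ℝ φ (T ψ) = ∫ s, ∫ t, k t s * (φ s * ψ t) ∂μ ∂μ := by
      rw [L2.inner_def]
      refine integral_congr_ae ?_
      filter_upwards [hT ψ] with s hs
      rw [hs]
      have : ∀ t, k t s * (φ s * ψ t) = φ s * (k s t * ψ t) := fun t => by rw [hsymm t s]; ring
      simp only [this]
      rw [integral_const_mul]
      simp [mul_comm]
    change inner ℝ (T φ) ψ = inner ℝ φ (T ψ)
    rw [e1, e2]
    refine integral_integral_swap ?_
    exact ((hψ.mul_prod hφ).congr (Eventually.of_forall fun p => mul_comm _ _)).bdd_mul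
      hk.aestronglyMeasurable (c := C) (Eventually.of_forall fun p => hC p.1 p.2)

/-- The vector `T v` is orthogonal to every eigenvector: by hypothesis when the eigenvalue is
nonzero, and by symmetry of `T` on the kernel. The eigenvectors span a dense subspace. -/
theorem map_eq_zero_of_orthogonal_eigenvectors {H : Type*} [NormedAddCommGroup H]
    [InnerProductSpace ℝ H] [CompleteSpace H] {T : H →L[ℝ] H} (hT : IsCompactOperator T)
    (hT' : T.IsSymmetric) {v : H}
    (hv : ∀ (μ : ℝ) (e : H), μ ≠ 0 → T e = μ • e → inner ℝ v e = 0) : T v = 0 := by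
  have h := ContinuousLinearMap.orthogonalComplement_iSup_eigenspaces_eq_bot hT hT'
  rw [← Submodule.mem_bot ℝ, ← h, Submodule.mem_orthogonal']
  intro u hu
  induction hu using Submodule.iSup_induction' with
  | mem μ x hx =>
    have hx' : T x = μ • x := Module.End.mem_eigenspace_iff.1 hx
    have : inner ℝ (T v) x = inner ℝ v (T x) := hT' v x
    rw [this]
    by_cases hμ : μ = 0
    · simp [hx', hμ]
    · rw [hx', inner_smul_right, hv μ x hμ hx', mul_zero]
  | zero => simp
  | add x y _ _ hx hy => rw [inner_add_right, hx, hy, add_zero]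

end SpectralTheory


/-! ### The Green operator of the singular Dirichlet problem -/

section StringOperator

open Set Filter Topology intervalIntegral

/-- The kernel of the inverse of `χ ↦ -√t (√t χ)''` on `L²(0, R)` with Dirichlet conditions. -/
noncomputable def stringKernel (R t s : ℝ) : ℝ :=
  if t ∈ Ioc 0 R ∧ s ∈ Ioc 0 R then min t s / √(t * s) - √(t * s) / R else 0

theorem stringKernel_symm (R t s : ℝ) : stringKernel R t s = stringKernel R s t := by
  simp only [stringKernel, and_comm, min_comm, mul_comm]

theorem measurable_stringKernel (R : ℝ) :
    Measurable (Function.uncurry (stringKernel R)) := by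
  unfold stringKernel Function.uncurry
  refine Measurable.ite ?_ (by fun_prop) measurable_const
  exact (measurableSet_Ioc.preimage measurable_fst).inter (measurableSet_Ioc.preimage measurable_snd)

/-- Both `min t s / √(ts)` and `√(ts) / R` lie in `[0, 1]`, so the singular weight leaves the kernel
bounded. -/
theorem abs_stringKernel_le (R t s : ℝ) : |stringKernel R t s| ≤ 1 := by
  unfold stringKernel
  split_ifs with h
  · obtain ⟨⟨ht, htR⟩, hs, hsR⟩ := h
    have hR : 0 < R := ht.trans_le htR
    have hp : 0 < √(t * s) := Real.sqrt_pos.2 (mul_pos ht hs)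
    have h1 : min t s / √(t * s) ≤ 1 := by
      rw [div_le_one hp]
      refine Real.le_sqrt_of_sq_le ?_
      rw [sq]
      exact mul_le_mul (min_le_left _ _) (min_le_right _ _) (le_min ht.le hs.le) ht.le
    have h2 : √(t * s) / R ≤ 1 := by
      rw [div_le_one hR]
      refine Real.sqrt_le_iff.2 ⟨hR.le, ?_⟩
      rw [sq]
      exact mul_le_mul htR hsR hs.le hR.le
    have h3 : 0 ≤ min t s / √(t * s) := div_nonneg (le_min ht.le hs.le) hp.le
    have h4 : 0 ≤ √(t * s) / R := by positivity
    rw [abs_le]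
    constructor <;> linarith
  · simp

/-- The solution of `Y'' = -q` on `(0, R)` vanishing at both endpoints. -/
noncomputable def stringPotential (R : ℝ) (q : ℝ → ℝ) (t : ℝ) : ℝ :=
  t * (∫ s in t..R, q s) + (∫ s in (0 : ℝ)..t, s * q s) - t * (R⁻¹ * ∫ s in (0 : ℝ)..R, s * q s)

/-- The derivative of `stringPotential`. -/
noncomputable def stringSlope (R : ℝ) (q : ℝ → ℝ) (t : ℝ) : ℝ :=
  (∫ s in t..R, q s) - R⁻¹ * ∫ s in (0 : ℝ)..R, s * q s

variable {R : ℝ} {q : ℝ → ℝ}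

theorem stringPotential_zero : stringPotential R q 0 = 0 := by simp [stringPotential]

theorem stringPotential_right (hR : 0 < R) : stringPotential R q R = 0 := by
  simp [stringPotential, hR.ne']

theorem continuousOn_stringSlope (hR : 0 < R) (hq : IntervalIntegrable q volume 0 R) :
    ContinuousOn (stringSlope R q) (Icc 0 R) := by
  unfold stringSlope
  refine ContinuousOn.sub ?_ continuousOn_const
  have := continuousOn_primitive_interval_left (μ := volume) (f := q) (a := 0) (b := R)
    (by rw [uIcc_of_le hR.le]; exact (intervalIntegrable_iff_integrableOn_Icc_of_le hR.le).1 hq)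
  rwa [uIcc_of_le hR.le] at this

theorem intervalIntegrable_id_mul (hq : IntervalIntegrable q volume 0 R) :
    IntervalIntegrable (fun s => s * q s) volume 0 R :=
  hq.continuousOn_mul continuousOn_id

theorem continuousOn_stringPotential (hR : 0 < R) (hq : IntervalIntegrable q volume 0 R) :
    ContinuousOn (stringPotential R q) (Icc 0 R) := by
  have h1 : ContinuousOn (fun t => ∫ s in (0 : ℝ)..t, s * q s) (Icc 0 R) := by
    have := continuousOn_primitive_interval (μ := volume) (f := fun s => s * q s) (a := 0) (b := R)
      (by rw [uIcc_of_le hR.le]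
          exact (intervalIntegrable_iff_integrableOn_Icc_of_le hR.le).1
            (intervalIntegrable_id_mul hq))
    rwa [uIcc_of_le hR.le] at this
  refine ((continuousOn_id.mul (continuousOn_stringSlope hR hq)).add h1).congr fun t _ => ?_
  simp only [stringPotential, stringSlope, Pi.add_apply, Pi.mul_apply, id]
  ring

theorem hasDerivAt_stringSlope (hq : IntervalIntegrable q volume 0 R)
    (hc : ContinuousOn q (Ioo 0 R)) {t : ℝ} (ht : t ∈ Ioo 0 R) :
    HasDerivAt (stringSlope R q) (-q t) t := by
  have hsub : uIcc t R ⊆ uIcc 0 R := by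
    rw [uIcc_of_le ht.2.le, uIcc_of_le (ht.1.trans ht.2).le]
    exact Icc_subset_Icc_left ht.1.le
  have := integral_hasDerivAt_left (hq.mono_set hsub)
    (hc.stronglyMeasurableAtFilter isOpen_Ioo t ht) (hc.continuousAt (isOpen_Ioo.mem_nhds ht))
  exact this.sub_const _

theorem hasDerivAt_stringPotential (hq : IntervalIntegrable q volume 0 R)
    (hc : ContinuousOn q (Ioo 0 R)) {t : ℝ} (ht : t ∈ Ioo 0 R) :
    HasDerivAt (stringPotential R q) (stringSlope R q t) t := by
  have hsub : uIcc 0 t ⊆ uIcc 0 R := by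
    rw [uIcc_of_le ht.1.le, uIcc_of_le (ht.1.trans ht.2).le]
    exact Icc_subset_Icc_right ht.2.le
  have hc' : ContinuousOn (fun s => s * q s) (Ioo 0 R) := continuousOn_id.mul hc
  have h1 := integral_hasDerivAt_right ((intervalIntegrable_id_mul hq).mono_set hsub)
    (hc'.stronglyMeasurableAtFilter isOpen_Ioo t ht) (hc'.continuousAt (isOpen_Ioo.mem_nhds ht))
  have h2 := ((hasDerivAt_id t).mul (hasDerivAt_stringSlope hq hc ht)).add h1
  refine (h2.congr_of_eventuallyEq (Eventually.of_forall fun t => ?_)).congr_deriv ?_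
  · simp only [stringPotential, stringSlope, Pi.add_apply, Pi.mul_apply, id]
    ring
  · simp

variable {n : ℝ → ℝ} {C : ℝ}

theorem intervalIntegrable_div_sqrt (hR : 0 < R)
    (hn : AEStronglyMeasurable n (volume.restrict (Ioc 0 R)))
    (hC : ∀ s ∈ Ioc 0 R, |n s| ≤ C) : IntervalIntegrable (fun s => n s / √s) volume 0 R := by
  have h1 : IntervalIntegrable (fun s : ℝ => s ^ (-(1 / 2) : ℝ)) volume 0 R :=
    intervalIntegrable_rpow' (by norm_num)
  rw [intervalIntegrable_iff_integrableOn_Ioc_of_le hR.le] at h1 ⊢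
  refine (h1.bdd_mul hn ((ae_restrict_iff' measurableSet_Ioc).2
    (Eventually.of_forall hC))).congr ?_
  filter_upwards [ae_restrict_mem measurableSet_Ioc] with s hs
  rw [Real.rpow_neg hs.1.le, ← Real.sqrt_eq_rpow, div_eq_mul_inv]

/-- The Green function of `-Y''` with Dirichlet conditions is `min t s - t s / R`; the kernel is
this divided by `√t √s`. Splitting the integral at `s = t` resolves the minimum. -/
theorem sqrt_mul_integral_stringKernel (hR : 0 < R)
    (hn : AEStronglyMeasurable n (volume.restrict (Ioc 0 R)))
    (hC : ∀ s ∈ Ioc 0 R, |n s| ≤ C) {t : ℝ} (ht : t ∈ Ioc 0 R) :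
    √t * ∫ s in Ioc 0 R, stringKernel R t s * n s = stringPotential R (fun s => n s / √s) t := by
  set q : ℝ → ℝ := fun s => n s / √s with hqdef
  have hq : IntervalIntegrable q volume 0 R := intervalIntegrable_div_sqrt hR hn hC
  have hsub1 : uIcc 0 t ⊆ uIcc 0 R := by
    rw [uIcc_of_le ht.1.le, uIcc_of_le hR.le]
    exact Icc_subset_Icc_right ht.2
  have hsub2 : uIcc t R ⊆ uIcc 0 R := by
    rw [uIcc_of_le ht.2, uIcc_of_le hR.le]
    exact Icc_subset_Icc_left ht.1.le
  have hm : IntervalIntegrable (fun s => min t s * q s) volume 0 R :=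
    hq.continuousOn_mul (by fun_prop)
  have h1 : √t * ∫ s in Ioc 0 R, stringKernel R t s * n s
      = ∫ s in (0 : ℝ)..R, (min t s * q s - t * (R⁻¹ * (s * q s))) := by
    rw [← MeasureTheory.integral_const_mul, intervalIntegral.integral_of_le hR.le]
    refine setIntegral_congr_fun measurableSet_Ioc fun s hs => ?_
    have h3 : √t * √t = t := Real.mul_self_sqrt ht.1.le
    have h4 : √s * √s = s := Real.mul_self_sqrt hs.1.le
    have h5 : 0 < √t := Real.sqrt_pos.2 ht.1
    have h6 : 0 < √s := Real.sqrt_pos.2 hs.1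
    simp only [stringKernel, ht, hs, and_self, if_true, hqdef, Real.sqrt_mul ht.1.le]
    field_simp
    rw [pow_two, pow_two, h3, h4]
    ring
  rw [h1, integral_sub hm (((intervalIntegrable_id_mul hq).const_mul _).const_mul _),
    intervalIntegral.integral_const_mul, intervalIntegral.integral_const_mul,
    ← integral_add_adjacent_intervals (hm.mono_set hsub1) (hm.mono_set hsub2), stringPotential]
  congr 1
  rw [add_comm]
  congr 1
  · rw [← intervalIntegral.integral_const_mul]
    refine integral_congr fun s hs => ?_
    rw [uIcc_of_le ht.2] at hs
    simp [min_eq_left hs.1]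
  · refine integral_congr fun s hs => ?_
    rw [uIcc_of_le ht.1.le] at hs
    simp [min_eq_right hs.2]

/-- Bootstrap: an eigenvector is only an `L²` class, but applying the operator once gives a bounded
representative `χ`. It is then a potential divided by `√t`, hence continuous inside, so the
potential is twice differentiable. -/
theorem exists_ode_of_stringKernel_eigenvector (hR : 0 < R) {κ : ℝ} (hκ : κ ≠ 0) {e : ℝ → ℝ}
    (he : Integrable e (volume.restrict (Ioc 0 R)))
    (heig : ∀ᵐ t ∂(volume.restrict (Ioc 0 R)), κ * e t = ∫ s in Ioc 0 R, stringKernel R t s * e s) :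
    ∃ (ψ p : ℝ → ℝ) (C : ℝ), ContinuousOn ψ (Icc 0 R) ∧ ContinuousOn p (Icc 0 R) ∧ ψ 0 = 0 ∧
      ψ R = 0 ∧ (∀ t ∈ Ioo 0 R, HasDerivAt ψ (p t) t) ∧
      (∀ t ∈ Ioo 0 R, HasDerivAt p (-(κ⁻¹ * ψ t / t)) t) ∧
      (∀ t ∈ Ioc 0 R, |ψ t / √t| ≤ C) ∧
      e =ᵐ[volume.restrict (Ioc 0 R)] fun t => ψ t / √t := by
  set χ : ℝ → ℝ := fun t => κ⁻¹ * ∫ s in Ioc 0 R, stringKernel R t s * e s with hχ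
  have heχ : e =ᵐ[volume.restrict (Ioc 0 R)] χ := by
    filter_upwards [heig] with t ht
    rw [hχ]
    simp only [← ht]
    field_simp
  have hχeq : ∀ t, κ * χ t = ∫ s in Ioc 0 R, stringKernel R t s * χ s := fun t => by
    have : ∫ s in Ioc 0 R, stringKernel R t s * χ s = ∫ s in Ioc 0 R, stringKernel R t s * e s :=
      integral_congr_ae (by filter_upwards [heχ] with s hs; rw [hs])
    rw [this, hχ]
    field_simp
  have hχm : AEStronglyMeasurable χ (volume.restrict (Ioc 0 R)) := he.1.congr heχ
  have hχC : ∀ s ∈ Ioc 0 R, |χ s| ≤ |κ⁻¹| * ∫ s in Ioc 0 R, ‖e s‖ := fun s _ => by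
    rw [hχ, abs_mul]
    gcongr
    rw [← Real.norm_eq_abs]
    refine norm_integral_le_of_norm_le he.norm (Eventually.of_forall fun t => ?_)
    rw [norm_mul]
    exact mul_le_of_le_one_left (norm_nonneg _) (abs_stringKernel_le R s t)
  set q : ℝ → ℝ := fun s => χ s / √s with hqdef
  have hq : IntervalIntegrable q volume 0 R := intervalIntegrable_div_sqrt hR hχm hχC
  have hY : ∀ t ∈ Ioc 0 R, χ t = κ⁻¹ * stringPotential R q t / √t := fun t ht => by
    have h6 : 0 < √t := Real.sqrt_pos.2 ht.1
    rw [← sqrt_mul_integral_stringKernel hR hχm hχC ht, ← hχeq]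
    field_simp
  have hYc := continuousOn_stringPotential hR hq
  have hqc : ContinuousOn q (Ioo 0 R) := by
    have : ContinuousOn (fun t => κ⁻¹ * stringPotential R q t / √t / √t) (Ioo 0 R) := by
      have hne : ∀ t ∈ Ioo 0 R, √t ≠ 0 := fun t ht => (Real.sqrt_pos.2 ht.1).ne'
      exact ((continuousOn_const.mul (hYc.mono Ioo_subset_Icc_self)).div
        Real.continuous_sqrt.continuousOn hne).div Real.continuous_sqrt.continuousOn hne
    refine this.congr fun t ht => ?_
    simp only [hqdef, hY t ⟨ht.1, ht.2.le⟩]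
  refine ⟨fun t => κ⁻¹ * stringPotential R q t, fun t => κ⁻¹ * stringSlope R q t,
    |κ⁻¹| * ∫ s in Ioc 0 R, ‖e s‖, continuousOn_const.mul hYc,
    continuousOn_const.mul (continuousOn_stringSlope hR hq), by simp [stringPotential_zero],
    by simp [stringPotential_right hR],
    fun t ht => (hasDerivAt_stringPotential hq hqc ht).const_mul _, fun t ht => ?_,
    fun t ht => ?_, ?_⟩
  · refine ((hasDerivAt_stringSlope hq hqc ht).const_mul κ⁻¹).congr_deriv ?_
    have h6 : 0 < √t := Real.sqrt_pos.2 ht.1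
    simp only [hqdef, hY t ⟨ht.1, ht.2.le⟩]
    rw [div_div, Real.mul_self_sqrt ht.1.le]
    ring
  · rw [← hY t ht]
    exact hχC t ht
  · filter_upwards [heχ, ae_restrict_mem measurableSet_Ioc] with t h1 h2
    rw [h1, hY t h2]

/-- Injectivity of the operator on bounded continuous functions: the potential of `n / √s` vanishes,
hence so does its second derivative `-n / √s`. -/
theorem eq_zero_of_integral_stringKernel_eq_zero (hR : 0 < R)
    (hn : ContinuousOn n (Ioc 0 R)) (hC : ∀ s ∈ Ioc 0 R, |n s| ≤ C)
    (h : ∀ᵐ t ∂(volume.restrict (Ioc 0 R)), ∫ s in Ioc 0 R, stringKernel R t s * n s = 0) :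
    ∀ t ∈ Ioo 0 R, n t = 0 := by
  have hnm := hn.aestronglyMeasurable (μ := volume) measurableSet_Ioc
  set q : ℝ → ℝ := fun s => n s / √s with hqdef
  have hq : IntervalIntegrable q volume 0 R := intervalIntegrable_div_sqrt hR hnm hC
  have hqc : ContinuousOn q (Ioo 0 R) := (hn.mono Ioo_subset_Ioc_self).div
    Real.continuous_sqrt.continuousOn fun t ht => (Real.sqrt_pos.2 ht.1).ne'
  have hY : EqOn (stringPotential R q) 0 (Ioo 0 R) := by
    refine Measure.eqOn_open_of_ae_eq (μ := volume) ?_ isOpen_Ioo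
      ((continuousOn_stringPotential hR hq).mono Ioo_subset_Icc_self) continuousOn_const
    have h' := ae_restrict_of_ae_restrict_of_subset Ioo_subset_Ioc_self h
    filter_upwards [h', ae_restrict_mem measurableSet_Ioo] with t h1 h2
    rw [← sqrt_mul_integral_stringKernel hR hnm hC ⟨h2.1, h2.2.le⟩, h1]
    simp
  have hS : EqOn (stringSlope R q) 0 (Ioo 0 R) := fun t ht =>
    (hasDerivAt_stringPotential hq hqc ht).unique
      ((hasDerivAt_const t (0 : ℝ)).congr_of_eventuallyEq
        (hY.eventuallyEq_of_mem (isOpen_Ioo.mem_nhds ht)))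
  intro t ht
  have := (hasDerivAt_stringSlope hq hqc ht).unique
      ((hasDerivAt_const t (0 : ℝ)).congr_of_eventuallyEq
        (hS.eventuallyEq_of_mem (isOpen_Ioo.mem_nhds ht)))
  simpa [hqdef, (Real.sqrt_pos.2 ht.1).ne'] using this

end StringOperator


/-! ### Uniqueness and sign of eigenvalues for `t y'' = -μ y` -/

section StringEquation

open Set Filter Topology

/-- `y` is a solution, with derivative `p`, of the singular equation `t y'' = -μ y` on `(0, R)` that
is `C¹` up to the endpoints and vanishes at `0`. -/
structure IsStringSolution (μ R : ℝ) (y p : ℝ → ℂ) : Prop where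
  continuousOn : ContinuousOn y (Icc 0 R)
  continuousOn_deriv : ContinuousOn p (Icc 0 R)
  map_zero : y 0 = 0
  hasDerivAt : ∀ t ∈ Ioo 0 R, HasDerivAt y (p t) t
  hasDerivAt_deriv : ∀ t ∈ Ioo 0 R, HasDerivAt p (-(μ * y t / t)) t

namespace IsStringSolution

variable {μ R : ℝ} {y p z q : ℝ → ℂ}

/-- Picard iteration survives the singularity: since `y` vanishes at `0`, a bound on `p` bounds `y s
/ s`, so integrating `p' = -μ y / s` gains one factor `|μ| t / (k + 1)`. -/
theorem norm_deriv_le (h : IsStringSolution μ R y p) (h0 : p 0 = 0) {M : ℝ}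
    (hM : ∀ t ∈ Icc 0 R, ‖p t‖ ≤ M) (k : ℕ) :
    ∀ t ∈ Icc 0 R, ‖p t‖ ≤ M * (|μ| * t) ^ k / k.factorial := by
  induction k with
  | zero => simpa using hM
  | succ k ih =>
    intro t ht
    have hM0 : 0 ≤ M := (norm_nonneg _).trans (hM t ht)
    have hsub : ∀ s ∈ Ioc 0 t, Icc 0 s ⊆ Icc 0 R ∧ Ioo 0 s ⊆ Ioo 0 R := fun s hs =>
      ⟨Icc_subset_Icc_right (hs.2.trans ht.2), Ioo_subset_Ioo_right (hs.2.trans ht.2)⟩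
    have hy : ∀ s ∈ Ioc 0 t, ‖y s‖ ≤ M * (|μ| * s) ^ k / k.factorial * s := fun s hs => by
      have e := intervalIntegral.integral_eq_sub_of_hasDerivAt_of_le hs.1.le
        (h.continuousOn.mono (hsub s hs).1) (fun x hx => h.hasDerivAt x ((hsub s hs).2 hx))
        ((h.continuousOn_deriv.mono (hsub s hs).1).intervalIntegrable_of_Icc hs.1.le)
      rw [h.map_zero, sub_zero] at e
      rw [← e]
      refine (intervalIntegral.norm_integral_le_of_norm_le_const
        (C := M * (|μ| * s) ^ k / k.factorial) fun x hx => ?_).trans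
        (by rw [sub_zero, abs_of_pos hs.1])
      rw [uIoc_of_le hs.1.le] at hx
      refine (ih x ((hsub s hs).1 ⟨hx.1.le, hx.2⟩)).trans ?_
      have := hx.1.le
      gcongr
      exact hx.2
    have hbd : ∀ s ∈ Ioc 0 t, ‖-(μ * y s / s : ℂ)‖ ≤ |μ| * (M * (|μ| * s) ^ k / k.factorial) :=
      fun s hs => by
        rw [norm_neg, norm_div, norm_mul, Complex.norm_real, Complex.norm_real, Real.norm_eq_abs,
          Real.norm_eq_abs, abs_of_pos hs.1, div_le_iff₀ hs.1, mul_assoc]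
        gcongr
        exact hy s hs
    have hgint : IntervalIntegrable (fun s : ℝ => |μ| * (M * (|μ| * s) ^ k / k.factorial)) volume
        0 t := Continuous.intervalIntegrable (by fun_prop) _ _
    rcases ht.1.eq_or_lt with h1 | h1
    · rw [← h1, h0]
      simp
    have hfint : IntervalIntegrable (fun s : ℝ => -(μ * y s / s : ℂ)) volume 0 t := by
      refine hgint.mono_fun' ?_ ?_
      · rw [uIoc_of_le ht.1]
        refine ContinuousOn.aestronglyMeasurable ?_ measurableSet_Ioc
        refine ((continuousOn_const.mul (h.continuousOn.mono
          (Ioc_subset_Icc_self.trans (hsub t ⟨h1, le_rfl⟩).1))).div (by fun_prop)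
          fun s hs => ?_).neg
        exact_mod_cast hs.1.ne'
      · rw [uIoc_of_le ht.1]
        filter_upwards [ae_restrict_mem measurableSet_Ioc] with s hs using hbd s hs
    have e := intervalIntegral.integral_eq_sub_of_hasDerivAt_of_le ht.1
      (h.continuousOn_deriv.mono (hsub t ⟨h1, le_rfl⟩).1)
      (fun x hx => h.hasDerivAt_deriv x ((hsub t ⟨h1, le_rfl⟩).2 hx)) hfint
    rw [h0, sub_zero] at e
    rw [← e]
    refine (intervalIntegral.norm_integral_le_of_norm_le ht.1
      (Eventually.of_forall hbd) hgint).trans (le_of_eq ?_)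
    have : ∀ s : ℝ, |μ| * (M * (|μ| * s) ^ k / k.factorial)
        = (|μ| * M * |μ| ^ k / k.factorial) * s ^ k := fun s => by rw [mul_pow]; ring
    simp only [this]
    rw [intervalIntegral.integral_const_mul, integral_pow, Nat.factorial_succ]
    have := Nat.factorial_pos k
    push_cast
    field_simp
    simp
    ring

theorem deriv_eq_zero (h : IsStringSolution μ R y p) (h0 : p 0 = 0) {t : ℝ} (ht : t ∈ Icc 0 R) :
    p t = 0 := by
  obtain ⟨M, hM⟩ := isCompact_Icc.exists_bound_of_continuousOn h.continuousOn_deriv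
  have h1 : Tendsto (fun k : ℕ => M * (|μ| * t) ^ k / k.factorial) atTop (𝓝 0) := by
    simpa [mul_div_assoc] using
      (FloorSemiring.tendsto_pow_div_factorial_atTop (|μ| * t)).const_mul M
  exact norm_le_zero_iff.1 (ge_of_tendsto' h1 fun k => h.norm_deriv_le h0 hM k t ht)

theorem eq_zero (h : IsStringSolution μ R y p) (h0 : p 0 = 0) {t : ℝ} (ht : t ∈ Icc 0 R) :
    y t = 0 := by
  have hsub : Icc 0 t ⊆ Icc 0 R := Icc_subset_Icc_right ht.2
  have e := intervalIntegral.integral_eq_sub_of_hasDerivAt_of_le ht.1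
    (h.continuousOn.mono hsub)
    (fun x hx => h.hasDerivAt x (Ioo_subset_Ioo_right ht.2 hx))
    ((h.continuousOn_deriv.mono hsub).intervalIntegrable_of_Icc ht.1)
  rw [h.map_zero, sub_zero] at e
  rw [← e, intervalIntegral.integral_congr (g := fun _ => 0) fun s hs =>
    h.deriv_eq_zero h0 (hsub (by rwa [uIcc_of_le ht.1] at hs))]
  simp

theorem smul_sub_smul (h : IsStringSolution μ R y p) (h' : IsStringSolution μ R z q) (a b : ℂ) :
    IsStringSolution μ R (fun t => a * y t - b * z t) fun t => a * p t - b * q t where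
  continuousOn := (continuousOn_const.mul h.continuousOn).sub
    (continuousOn_const.mul h'.continuousOn)
  continuousOn_deriv := (continuousOn_const.mul h.continuousOn_deriv).sub
    (continuousOn_const.mul h'.continuousOn_deriv)
  map_zero := by simp [h.map_zero, h'.map_zero]
  hasDerivAt t ht := ((h.hasDerivAt t ht).const_mul a).sub ((h'.hasDerivAt t ht).const_mul b)
  hasDerivAt_deriv t ht := by
    refine (((h.hasDerivAt_deriv t ht).const_mul a).sub
      ((h'.hasDerivAt_deriv t ht).const_mul b)).congr_deriv ?_
    ring

/-- Solutions are determined up to a factor. -/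
theorem mul_eq_mul (h : IsStringSolution μ R y p) (h' : IsStringSolution μ R z q) {t : ℝ}
    (ht : t ∈ Icc 0 R) : q 0 * y t = p 0 * z t :=
  -- The combination `q(0) y - p(0) z` is a solution with zero slope at `0`.
  sub_eq_zero.1 ((h.smul_sub_smul h' (q 0) (p 0)).eq_zero (by ring) ht)

end IsStringSolution

/-- The eigenvalues of the Dirichlet problem for `t ψ'' = -μ ψ` are nonnegative. -/
theorem eq_zero_of_stringEquation_neg {R μ : ℝ} (hμ : μ < 0) {ψ p : ℝ → ℝ}
    (hψ : ContinuousOn ψ (Icc 0 R)) (h0 : ψ 0 = 0) (hR : ψ R = 0)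
    (h1 : ∀ t ∈ Ioo 0 R, HasDerivAt ψ (p t) t)
    (h2 : ∀ t ∈ Ioo 0 R, HasDerivAt p (-(μ * ψ t / t)) t) {t : ℝ} (ht : t ∈ Icc 0 R) :
    ψ t = 0 := by
  -- For negative `μ` the function `ψ²` is convex; it is nonnegative and vanishes at both endpoints.
  have hc : ConvexOn ℝ (Icc 0 R) (fun t => ψ t ^ 2) := by
    refine convexOn_of_hasDerivWithinAt2_nonneg (convex_Icc 0 R) (hψ.pow 2)
      (f' := fun t => 2 * ψ t * p t)
      (f'' := fun t => 2 * p t ^ 2 + 2 * ψ t * (-(μ * ψ t / t))) ?_ ?_ ?_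
    · intro t ht
      rw [interior_Icc] at ht ⊢
      refine ((h1 t ht).pow 2).hasDerivWithinAt.congr_deriv ?_
      simp
    · intro t ht
      rw [interior_Icc] at ht ⊢
      refine (((h1 t ht).const_mul 2).mul (h2 t ht)).hasDerivWithinAt.congr_deriv ?_
      ring
    · intro t ht
      rw [interior_Icc] at ht
      have : 2 * ψ t * (-(μ * ψ t / t)) = 2 * (-μ) * ψ t ^ 2 / t := by ring
      rw [this]
      have := ht.1
      have : 0 < -μ := by linarith
      positivity
  have := hc.le_max_of_mem_Icc (left_mem_Icc.2 (ht.1.trans ht.2))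
    (right_mem_Icc.2 (ht.1.trans ht.2)) ht
  simp only [h0, hR, ne_eq, OfNat.ofNat_ne_zero, not_false_eq_true, zero_pow, max_self] at this
  exact pow_eq_zero_iff two_ne_zero |>.1 (le_antisymm this (sq_nonneg _))

end StringEquation


/-! ### Circle integrals as functions of the radius -/

section CircleMeans

open Set Filter Topology Complex
open scoped ContDiff Real

/-- Twice the Wirtinger derivative `∂f/∂z̄`. -/
noncomputable def dbar (f : ℂ → ℂ) (z : ℂ) : ℂ := fderiv ℝ f z 1 + I * fderiv ℝ f z I

/-- Twice the Wirtinger derivative `∂f/∂z`. -/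
noncomputable def dz (f : ℂ → ℂ) (z : ℂ) : ℂ := fderiv ℝ f z 1 - I * fderiv ℝ f z I

/-- The integral of `f` over a circle with respect to the angle. -/
noncomputable def circleMean (f : ℂ → ℂ) (x : ℂ) (ρ : ℝ) : ℂ :=
  ∫ θ in (0 : ℝ)..(2 * π), f (circleMap x ρ θ)

/-- The contour integral of `f` over a circle, divided by `i` times the radius. -/
noncomputable def circleMoment (f : ℂ → ℂ) (x : ℂ) (ρ : ℝ) : ℂ :=
  ∫ θ in (0 : ℝ)..(2 * π), f (circleMap x ρ θ) * exp (θ * I)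

theorem fderiv_eq_wirtinger (f : ℂ → ℂ) (z v : ℂ) :
    fderiv ℝ f z v = (v * dz f z + (starRingEnd ℂ) v * dbar f z) / 2 := by
  have hv : v = v.re • (1 : ℂ) + v.im • I := by simp
  conv_lhs => rw [hv]
  rw [map_add, map_smul, map_smul, real_smul, real_smul, dz, dbar]
  conv_rhs => rw [← re_add_im v]
  simp only [map_add, map_mul, conj_ofReal, conj_I]
  linear_combination ((v.im : ℂ) * fderiv ℝ f z I) * I_sq

variable {f : ℂ → ℂ}

theorem contDiff_dbar (hf : ContDiff ℝ ∞ f) : ContDiff ℝ ∞ (dbar f) := by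
  have h : ContDiff ℝ ∞ (fderiv ℝ f) := hf.fderiv_right (by simp)
  unfold dbar
  fun_prop

theorem contDiff_dz (hf : ContDiff ℝ ∞ f) : ContDiff ℝ ∞ (dz f) := by
  have h : ContDiff ℝ ∞ (fderiv ℝ f) := hf.fderiv_right (by simp)
  unfold dz
  fun_prop

@[fun_prop]
theorem continuous_circleMap_uncurry (x : ℂ) :
    Continuous fun p : ℝ × ℝ => circleMap x p.1 p.2 := by
  unfold circleMap
  fun_prop

theorem hasDerivAt_intervalIntegral_of_continuous {F F' : ℝ → ℝ → ℂ} {a b : ℝ}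
    (hF : ∀ ρ, Continuous (F ρ)) (hF' : Continuous (Function.uncurry F'))
    (h : ∀ ρ θ, HasDerivAt (fun ρ => F ρ θ) (F' ρ θ) ρ) (ρ : ℝ) :
    HasDerivAt (fun ρ => ∫ θ in a..b, F ρ θ) (∫ θ in a..b, F' ρ θ) ρ := by
  obtain ⟨C, hC⟩ := ((isCompact_closedBall ρ 1).prod (isCompact_uIcc (a := a) (b := b))
    ).exists_bound_of_continuousOn hF'.continuousOn
  refine (intervalIntegral.hasDerivAt_integral_of_dominated_loc_of_deriv_le (bound := fun _ => C)
    (Metric.closedBall_mem_nhds ρ one_pos)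
    (Eventually.of_forall fun ρ => (hF ρ).aestronglyMeasurable)
    ((hF ρ).intervalIntegrable _ _)
    (hF'.comp (Continuous.prodMk_right ρ)).aestronglyMeasurable
    (Eventually.of_forall fun θ hθ s hs => hC (s, θ) ⟨hs, uIoc_subset_uIcc hθ⟩)
    intervalIntegrable_const
    (Eventually.of_forall fun θ _ s _ => h s θ)).2

theorem hasDerivAt_circleMap_radius (x : ℂ) (ρ θ : ℝ) :
    HasDerivAt (fun ρ : ℝ => circleMap x ρ θ) (exp (θ * I)) ρ := by
  unfold circleMap
  simpa using ((hasDerivAt_id ρ).ofReal_comp.mul_const (exp (θ * I))).const_add x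

theorem conj_exp_ofReal_mul_I (θ : ℝ) : (starRingEnd ℂ) (exp (θ * I)) = exp (-(θ * I)) := by
  rw [← exp_conj]
  simp

theorem hasDerivAt_comp_circleMap_radius (hf : ContDiff ℝ ∞ f) (x : ℂ) (ρ θ : ℝ) :
    HasDerivAt (fun ρ : ℝ => f (circleMap x ρ θ))
      ((exp (θ * I) * dz f (circleMap x ρ θ) + exp (-(θ * I)) * dbar f (circleMap x ρ θ)) / 2)
      ρ := by
  have h := ((hf.differentiable (by simp)) (circleMap x ρ θ)).hasFDerivAt.comp_hasDerivAt ρ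
    (hasDerivAt_circleMap_radius x ρ θ)
  rwa [fderiv_eq_wirtinger, conj_exp_ofReal_mul_I] at h

theorem hasDerivAt_comp_circleMap_angle (hf : ContDiff ℝ ∞ f) (x : ℂ) (ρ θ : ℝ) :
    HasDerivAt (fun θ : ℝ => f (circleMap x ρ θ))
      (I * ρ * ((exp (θ * I) * dz f (circleMap x ρ θ)
        - exp (-(θ * I)) * dbar f (circleMap x ρ θ)) / 2)) θ := by
  have h := ((hf.differentiable (by simp)) (circleMap x ρ θ)).hasFDerivAt.comp_hasDerivAt θ
    (hasDerivAt_circleMap x ρ θ)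
  rw [fderiv_eq_wirtinger] at h
  refine h.congr_deriv ?_
  simp only [circleMap, map_mul, map_add, map_zero, conj_ofReal, conj_I, conj_exp_ofReal_mul_I]
  ring

theorem integral_deriv_circle_eq_zero {g g' : ℝ → ℂ} (hg : ∀ θ, HasDerivAt g (g' θ) θ)
    (hg' : Continuous g') (hper : g (2 * π) = g 0) : ∫ θ in (0 : ℝ)..(2 * π), g' θ = 0 := by
  rw [intervalIntegral.integral_eq_sub_of_hasDerivAt (fun θ _ => hg θ)
    (hg'.intervalIntegrable _ _), hper, sub_self]

theorem circleMap_two_pi (x : ℂ) (ρ : ℝ) : circleMap x ρ (2 * π) = circleMap x ρ 0 := by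
  simpa using periodic_circleMap x ρ 0

theorem continuous_circleMoment (hf : Continuous f) (x : ℂ) : Continuous (circleMoment f x) := by
  refine intervalIntegral.continuous_parametric_intervalIntegral_of_continuous' ?_ _ _
  have : Continuous fun p : ℝ × ℝ => f (circleMap x p.1 p.2) :=
    hf.comp (continuous_circleMap_uncurry x)
  unfold Function.uncurry
  fun_prop

theorem continuous_circleMean (hf : Continuous f) (x : ℂ) : Continuous (circleMean f x) := by
  refine intervalIntegral.continuous_parametric_intervalIntegral_of_continuous' ?_ _ _
  exact hf.comp (continuous_circleMap_uncurry x)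

theorem circleMean_zero (f : ℂ → ℂ) (x : ℂ) : circleMean f x 0 = 2 * π * f x := by
  simp [circleMean]

/-- Infinitesimal Green theorem: the angular derivative of `f e^{iθ}` integrates to zero over the
circle, and subtracting a multiple of it removes the `dz f` term from the radial derivative. -/
theorem hasDerivAt_mul_circleMoment (hf : ContDiff ℝ ∞ f) (x : ℂ) (ρ : ℝ) :
    HasDerivAt (fun ρ : ℝ => ρ * circleMoment f x ρ) (ρ * circleMean (dbar f) x ρ) ρ := by
  have c0 := hf.continuous
  have c1 := (contDiff_dz hf).continuous
  have c2 := (contDiff_dbar hf).continuous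
  have cu := continuous_circleMap_uncurry x
  have h1 : HasDerivAt (circleMoment f x) (∫ θ in (0 : ℝ)..(2 * π),
      (exp (θ * I) * dz f (circleMap x ρ θ) + exp (-(θ * I)) * dbar f (circleMap x ρ θ)) / 2
        * exp (θ * I)) ρ := by
    refine hasDerivAt_intervalIntegral_of_continuous
      (F := fun ρ θ => f (circleMap x ρ θ) * exp (θ * I))
      (F' := fun ρ θ => (exp (θ * I) * dz f (circleMap x ρ θ)
        + exp (-(θ * I)) * dbar f (circleMap x ρ θ)) / 2 * exp (θ * I)) ?_ ?_ ?_ ρ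
    · intro ρ
      fun_prop
    · unfold Function.uncurry
      fun_prop
    · intro ρ θ
      exact (hasDerivAt_comp_circleMap_radius hf x ρ θ).mul_const _
  have h2 := (hasDerivAt_id ρ).ofReal_comp.mul h1
  refine h2.congr_deriv ?_
  have h3 := integral_deriv_circle_eq_zero
    (g := fun θ => f (circleMap x ρ θ) * exp (θ * I))
    (fun θ => (hasDerivAt_comp_circleMap_angle hf x ρ θ).mul
      ((hasDerivAt_id θ).ofReal_comp.mul_const I).cexp) (by fun_prop)
      (by simp [circleMap_two_pi])
  simp only [id, ofReal_one, one_mul] at h3 ⊢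
  rw [circleMoment, circleMean, ← intervalIntegral.integral_const_mul,
    ← intervalIntegral.integral_const_mul, ← intervalIntegral.integral_add
      (Continuous.intervalIntegrable (by fun_prop) _ _)
      (Continuous.intervalIntegrable (by fun_prop) _ _)]
  rw [← sub_eq_zero, ← intervalIntegral.integral_sub
      (Continuous.intervalIntegrable (by fun_prop) _ _)
      (Continuous.intervalIntegrable (by fun_prop) _ _)]
  have h4 : (0 : ℂ) = -I * 0 := by simp
  rw [h4, ← h3, ← intervalIntegral.integral_const_mul]
  refine intervalIntegral.integral_congr fun θ _ => ?_
  have h5 : exp (-(θ * I)) * exp (θ * I) = 1 := by rw [← exp_add]; simp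
  linear_combination (f (circleMap x ρ θ) * exp (θ * I)
    + ρ * (exp (θ * I) * dz f (circleMap x ρ θ)
    - exp (-(θ * I)) * dbar f (circleMap x ρ θ)) / 2 * exp (θ * I)) * I_sq
    + ρ * dbar f (circleMap x ρ θ) * h5

/-- Here the vanishing integral of the angular derivative trades `dbar f` for `dz f`; that
derivative carries a factor `ρ`, whence `ρ ≠ 0`. -/
theorem hasDerivAt_circleMean (hf : ContDiff ℝ ∞ f) (x : ℂ) {ρ : ℝ} (hρ : ρ ≠ 0) :
    HasDerivAt (circleMean f x) (circleMoment (dz f) x ρ) ρ := by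
  have c0 := hf.continuous
  have c1 := (contDiff_dz hf).continuous
  have c2 := (contDiff_dbar hf).continuous
  have cu := continuous_circleMap_uncurry x
  have h1 : HasDerivAt (circleMean f x) (∫ θ in (0 : ℝ)..(2 * π),
      (exp (θ * I) * dz f (circleMap x ρ θ) + exp (-(θ * I)) * dbar f (circleMap x ρ θ)) / 2)
        ρ := by
    refine hasDerivAt_intervalIntegral_of_continuous
      (F := fun ρ θ => f (circleMap x ρ θ))
      (F' := fun ρ θ => (exp (θ * I) * dz f (circleMap x ρ θ)
        + exp (-(θ * I)) * dbar f (circleMap x ρ θ)) / 2) ?_ ?_ ?_ ρ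
    · intro ρ
      fun_prop
    · unfold Function.uncurry
      fun_prop
    · intro ρ θ
      exact hasDerivAt_comp_circleMap_radius hf x ρ θ
  refine h1.congr_deriv ?_
  have h3 := integral_deriv_circle_eq_zero
    (g := fun θ => f (circleMap x ρ θ))
    (fun θ => hasDerivAt_comp_circleMap_angle hf x ρ θ) (by fun_prop)
      (by simp [circleMap_two_pi])
  rw [intervalIntegral.integral_const_mul] at h3
  have h4 := (mul_eq_zero.1 h3).resolve_left (mul_ne_zero I_ne_zero (ofReal_ne_zero.2 hρ))
  rw [circleMoment, ← sub_eq_zero, ← intervalIntegral.integral_sub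
      (Continuous.intervalIntegrable (by fun_prop) _ _)
      (Continuous.intervalIntegrable (by fun_prop) _ _)]
  have h5 : (0 : ℂ) = -1 * 0 := by simp
  rw [h5, ← h4, ← intervalIntegral.integral_const_mul]
  refine intervalIntegral.integral_congr fun θ _ => ?_
  ring

/-- The contour integral of `f` over the circle of squared radius `t`, divided by `i`. -/
noncomputable def sqContour (f : ℂ → ℂ) (x : ℂ) (t : ℝ) : ℂ := √t * circleMoment f x √t

/-- The derivative of `sqContour f x`. -/
noncomputable def sqContourDeriv (f : ℂ → ℂ) (x : ℂ) (t : ℝ) : ℂ := circleMean (dbar f) x √t / 2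

theorem continuous_sqContour (hf : Continuous f) (x : ℂ) : Continuous (sqContour f x) := by
  have := continuous_circleMoment hf x
  unfold sqContour
  fun_prop

theorem continuous_sqContourDeriv (hf : ContDiff ℝ ∞ f) (x : ℂ) :
    Continuous (sqContourDeriv f x) := by
  have := continuous_circleMean (contDiff_dbar hf).continuous x
  unfold sqContourDeriv
  fun_prop

theorem sqContour_zero (f : ℂ → ℂ) (x : ℂ) : sqContour f x 0 = 0 := by simp [sqContour]

theorem sqContourDeriv_zero (f : ℂ → ℂ) (x : ℂ) : sqContourDeriv f x 0 = π * dbar f x := by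
  simp [sqContourDeriv, circleMean_zero]
  ring

theorem hasDerivAt_sqContour (hf : ContDiff ℝ ∞ f) (x : ℂ) {t : ℝ} (ht : 0 < t) :
    HasDerivAt (sqContour f x) (sqContourDeriv f x t) t := by
  refine ((hasDerivAt_mul_circleMoment hf x √t).scomp t
    (Real.hasDerivAt_sqrt ht.ne')).congr_deriv ?_
  have : (√t : ℂ) ≠ 0 := ofReal_ne_zero.2 (Real.sqrt_pos.2 ht).ne'
  rw [sqContourDeriv, real_smul]
  push_cast
  field_simp

theorem hasDerivAt_sqContourDeriv (hf : ContDiff ℝ ∞ f) (x : ℂ) {t : ℝ} (ht : 0 < t) :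
    HasDerivAt (sqContourDeriv f x) (circleMoment (dz (dbar f)) x √t / (4 * √t)) t := by
  refine (((hasDerivAt_circleMean (contDiff_dbar hf) x (Real.sqrt_pos.2 ht).ne').scomp t
    (Real.hasDerivAt_sqrt ht.ne')).div_const 2).congr_deriv ?_
  have : (√t : ℂ) ≠ 0 := ofReal_ne_zero.2 (Real.sqrt_pos.2 ht).ne'
  rw [real_smul]
  push_cast
  field_simp
  ring

theorem circleMoment_const_mul (c : ℂ) (f : ℂ → ℂ) (x : ℂ) (ρ : ℝ) :
    circleMoment (fun z => c * f z) x ρ = c * circleMoment f x ρ := by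
  simp [circleMoment, mul_assoc]

/-- In the squared radius the radial equation takes the form `4 t y'' = y_Δ`, where `y_Δ` is formed
from the Laplacian, so a Helmholtz eigenfunction yields a solution about each centre. -/
theorem isStringSolution_sqContour (hf : ContDiff ℝ ∞ f) {μ : ℝ}
    (h : ∀ z, dz (dbar f) z = -(4 * μ) * f z) (x : ℂ) (R : ℝ) :
    IsStringSolution μ R (sqContour f x) (sqContourDeriv f x) where
  continuousOn := (continuous_sqContour hf.continuous x).continuousOn
  continuousOn_deriv := (continuous_sqContourDeriv hf x).continuousOn
  map_zero := sqContour_zero f x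
  hasDerivAt t ht := hasDerivAt_sqContour hf x ht.1
  hasDerivAt_deriv t ht := by
    refine (hasDerivAt_sqContourDeriv hf x ht.1).congr_deriv ?_
    rw [funext h, circleMoment_const_mul, sqContour]
    have h1 : (√t : ℂ) ≠ 0 := ofReal_ne_zero.2 (Real.sqrt_pos.2 ht.1).ne'
    have h2 : (t : ℂ) = √t * √t := by rw [← ofReal_mul, Real.mul_self_sqrt ht.1.le]
    rw [h2]
    field_simp

theorem differentiable_of_dbar_eq_zero (hf : ContDiff ℝ ∞ f) (h : ∀ z, dbar f z = 0) :
    Differentiable ℂ f := fun z => by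
  rw [differentiableAt_complex_iff_differentiableAt_real]
  refine ⟨hf.differentiable (by simp) z, ?_⟩
  have := h z
  rw [dbar] at this
  rw [smul_eq_mul]
  linear_combination (-I) * this + fderiv ℝ f z I * I_sq

/-! ### The plane wave and the Bessel function -/

theorem hasFDerivAt_planeWave (l : ℝ) (c z : ℂ) :
    HasFDerivAt (fun z : ℂ => c * exp (-(l * z.im) * I))
      ((c * (-l * I * exp (-(l * z.im) * I))) • (ofRealCLM.comp imCLM)) z := by
  have h1 : HasFDerivAt (fun z : ℂ => (z.im : ℂ)) (ofRealCLM.comp imCLM) z :=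
    (ofRealCLM.comp imCLM).hasFDerivAt
  refine ((((h1.const_mul (l : ℂ)).neg.mul_const I).cexp).const_mul c).congr_fderiv ?_
  ext
  simp
  ring

theorem contDiff_planeWave (l : ℝ) : ContDiff ℝ ∞ fun z : ℂ => exp (-(l * z.im) * I) := by
  have h1 : ContDiff ℝ ∞ (fun z : ℂ => (z.im : ℂ)) := (ofRealCLM.comp imCLM).contDiff
  fun_prop

theorem dbar_planeWave (l : ℝ) (z : ℂ) :
    dbar (fun z : ℂ => exp (-(l * z.im) * I)) z = l * exp (-(l * z.im) * I) := by
  have h := (hasFDerivAt_planeWave l 1 z).fderiv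
  simp only [one_mul] at h
  rw [dbar, h]
  simp
  linear_combination (-l * exp (-(l * z.im * I))) * I_sq

theorem dz_dbar_planeWave (l : ℝ) (z : ℂ) :
    dz (dbar fun z : ℂ => exp (-(l * z.im) * I)) z
      = -(4 * ((l ^ 2 / 4 : ℝ) : ℂ)) * exp (-(l * z.im) * I) := by
  rw [funext (dbar_planeWave l), dz, (hasFDerivAt_planeWave l l z).fderiv]
  simp
  linear_combination (l ^ 2 * exp (-(l * z.im * I))) * I_sq

/-- The integrand is `exp (i (θ - lρ sin θ))`; the reflection `θ ↦ 2π - θ` conjugates it, which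
folds the circle onto Bessel's integral over `[0, π]`. -/
theorem circleMoment_planeWave (l ρ : ℝ) :
    circleMoment (fun z : ℂ => exp (-(l * z.im) * I)) 0 ρ = 2 * π * besselJ 1 (l * ρ) := by
  set g : ℝ → ℝ := fun τ => τ - l * ρ * Real.sin τ with hg
  have h1 : circleMoment (fun z : ℂ => exp (-(l * z.im) * I)) 0 ρ
      = ∫ θ in (0 : ℝ)..(2 * π), exp (g θ * I) := by
    refine intervalIntegral.integral_congr fun θ _ => ?_
    simp only [← exp_add, hg]
    congr 1
    simp [circleMap, exp_ofReal_mul_I_im]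
    ring
  have hint : ∀ a b, IntervalIntegrable (fun θ : ℝ => exp (g θ * I)) volume a b := fun a b =>
    Continuous.intervalIntegrable (by fun_prop) _ _
  have h2 : ∫ θ in π..(2 * π), exp (g θ * I) = ∫ θ in (0 : ℝ)..π, exp (-(g θ * I)) := by
    have := intervalIntegral.integral_comp_sub_left (a := 0) (b := π)
      (fun θ : ℝ => exp (g θ * I)) (2 * π)
    rw [sub_zero, show 2 * π - π = π by ring] at this
    rw [← this]
    refine intervalIntegral.integral_congr fun θ _ => ?_
    have : (g (2 * π - θ) : ℂ) * I = -(g θ * I) + 2 * π * I := by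
      simp only [hg, Real.sin_two_pi_sub]
      push_cast
      ring
    simp only [this, exp_add, exp_two_pi_mul_I, mul_one]
  rw [h1, ← intervalIntegral.integral_add_adjacent_intervals (hint 0 π) (hint π (2 * π)), h2,
    ← intervalIntegral.integral_add (hint 0 π) (Continuous.intervalIntegrable (by fun_prop) _ _),
    besselJ]
  have h3 : ∀ θ : ℝ, exp (g θ * I) + exp (-(g θ * I)) = ((2 * Real.cos (g θ) : ℝ) : ℂ) := fun θ => by
    push_cast
    rw [← neg_mul, two_cos]
  simp only [h3]
  rw [intervalIntegral.integral_ofReal, intervalIntegral.integral_const_mul]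
  push_cast
  simp only [one_mul]
  have : (π : ℂ) ≠ 0 := ofReal_ne_zero.2 Real.pi_ne_zero
  field_simp
  rfl

end CircleMeans


/-! ### Completeness of the Dirichlet eigenfunctions -/

section StringCompleteness

open Set Filter Topology

/-- The Dirichlet eigenfunctions of `t ψ'' = -μ ψ` are complete. -/
theorem eq_zero_of_orthogonal_eigenfunctions {R : ℝ} (hR : 0 < R) {n : ℝ → ℝ}
    (hn : ContinuousOn n (Icc 0 R))
    (h : ∀ (μ : ℝ) (ψ p : ℝ → ℝ), 0 < μ →
      IsStringSolution μ R (fun t => (ψ t : ℂ)) (fun t => (p t : ℂ)) → ψ R = 0 →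
      (∃ C, ∀ t ∈ Ioc 0 R, |ψ t / √t| ≤ C) → ∫ t in Ioc 0 R, n t * (ψ t / √t) = 0) :
    ∀ t ∈ Ioo 0 R, n t = 0 := by
  obtain ⟨C, hC⟩ := isCompact_Icc.exists_bound_of_continuousOn hn
  obtain ⟨T, hT, hTc, hTs⟩ := exists_kernelOperator (volume.restrict (Ioc 0 R))
    (measurable_stringKernel R) (abs_stringKernel_le R) (stringKernel_symm R)
  have hnI := hn.mono (Ioc_subset_Icc_self (a := (0 : ℝ)) (b := R))
  have hnL : MemLp n 2 (volume.restrict (Ioc 0 R)) :=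
    MemLp.of_bound (hnI.aestronglyMeasurable measurableSet_Ioc) C
      ((ae_restrict_mem measurableSet_Ioc).mono fun t ht => hC t (Ioc_subset_Icc_self ht))
  have hv : T hnL.toLp = 0 := by
    refine map_eq_zero_of_orthogonal_eigenvectors hTc hTs fun κ e hκ he => ?_
    have heig : ∀ᵐ t ∂(volume.restrict (Ioc 0 R)),
        κ * e t = ∫ s in Ioc 0 R, stringKernel R t s * e s := by
      filter_upwards [hT e, Lp.coeFn_smul κ e] with t h1 h2
      rw [← h1, he, h2]
      rfl
    obtain ⟨ψ, p, D, hψ, hp, hψ0, hψR, h1, h2, hD, hae⟩ :=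
      exists_ode_of_stringKernel_eigenvector hR hκ
        ((Lp.memLp e).integrable (by norm_num)) heig
    have hinner : inner ℝ hnL.toLp e = ∫ t in Ioc 0 R, n t * (ψ t / √t) := by
      rw [L2.inner_def]
      refine integral_congr_ae ?_
      filter_upwards [hnL.coeFn_toLp, hae] with t h3 h4
      rw [h3, h4]
      simp [mul_comm]
    rw [hinner]
    -- An operator eigenvalue `κ` corresponds to `μ = κ⁻¹`; a negative one has only the zero
    -- eigenfunction.
    rcases hκ.lt_or_gt with hneg | hpos
    · rw [setIntegral_congr_fun measurableSet_Ioc (g := fun _ => 0) fun t ht => by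
        simp [eq_zero_of_stringEquation_neg (inv_lt_zero.2 hneg) hψ hψ0 hψR h1 h2
          (Ioc_subset_Icc_self ht)]]
      simp
    · refine h κ⁻¹ ψ p (inv_pos.2 hpos) ?_ hψR ⟨D, hD⟩
      exact ⟨Complex.continuous_ofReal.comp_continuousOn hψ,
        Complex.continuous_ofReal.comp_continuousOn hp, by simp [hψ0],
        fun t ht => (h1 t ht).ofReal_comp,
        fun t ht => (h2 t ht).ofReal_comp.congr_deriv (by push_cast; rfl)⟩
  refine eq_zero_of_integral_stringKernel_eq_zero hR hnI
    (fun s hs => hC s (Ioc_subset_Icc_self hs)) ?_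
  have h0 : T hnL.toLp =ᵐ[volume.restrict (Ioc 0 R)] 0 := by
    rw [hv]
    exact Lp.coeFn_zero _ _ _
  filter_upwards [hT hnL.toLp, h0] with t h1 h2
  have h3 : ∫ s in Ioc 0 R, stringKernel R t s * n s
      = ∫ s in Ioc 0 R, stringKernel R t s * hnL.toLp n s :=
    integral_congr_ae (by filter_upwards [hnL.coeFn_toLp] with s hs; rw [hs])
  rw [h3, ← h1, h2]
  rfl

end StringCompleteness

/-! ### Superpositions of translates -/

section TranslateIntegral

open Set Filter Topology Complex
open scoped ContDiff Real

variable {α : Type*} [MeasurableSpace α] {ν : Measure α} {c : α → ℂ} {k : α → ℂ}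
  {B C : ℝ}

/-- The weighted integral `∫ k(a) f(x + c(a)) dν(a)` of translates of `f`. -/
noncomputable def translateIntegral {E : Type*} [NormedAddCommGroup E] [NormedSpace ℂ E]
    (ν : Measure α) (c k : α → ℂ) (f : ℂ → E) (x : ℂ) : E :=
  ∫ a, k a • f (x + c a) ∂ν

section

theorem exists_bound_translate {E : Type*} [NormedAddCommGroup E] {f : ℂ → E} (hf : Continuous f) (hc : ∀ᵐ a ∂ν, ‖c a‖ ≤ B)
    (x : ℂ) : ∃ M, 0 ≤ M ∧ ∀ᵐ a ∂ν, ∀ y ∈ Metric.closedBall x 1, ‖f (y + c a)‖ ≤ M := by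
  obtain ⟨M, hM⟩ := (isCompact_closedBall x (1 + B)).exists_bound_of_continuousOn hf.continuousOn
  refine ⟨max M 0, le_max_right _ _, hc.mono fun a ha y hy => (hM _ ?_).trans (le_max_left _ _)⟩
  rw [mem_closedBall_iff_norm] at hy ⊢
  calc ‖y + c a - x‖ = ‖(y - x) + c a‖ := by ring_nf
    _ ≤ ‖y - x‖ + ‖c a‖ := norm_add_le _ _
    _ ≤ 1 + B := add_le_add hy ha

variable {E : Type*} [NormedAddCommGroup E] [NormedSpace ℂ E]

theorem aestronglyMeasurable_translate {f : ℂ → E} (hf : Continuous f) (hcm : Measurable c)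
    (hkm : AEStronglyMeasurable k ν) (x : ℂ) :
    AEStronglyMeasurable (fun a => k a • f (x + c a)) ν :=
  hkm.smul (hf.comp_aestronglyMeasurable (hcm.const_add x).aestronglyMeasurable)

variable [IsFiniteMeasure ν]

theorem integrable_translate {f : ℂ → E} (hf : Continuous f) (hcm : Measurable c)
    (hkm : AEStronglyMeasurable k ν) (hc : ∀ᵐ a ∂ν, ‖c a‖ ≤ B) (hk : ∀ᵐ a ∂ν, ‖k a‖ ≤ C)
    (x : ℂ) : Integrable (fun a => k a • f (x + c a)) ν := by
  obtain ⟨M, hM0, hM⟩ := exists_bound_translate hf hc x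
  refine Integrable.of_bound (aestronglyMeasurable_translate hf hcm hkm x) (C * M) ?_
  filter_upwards [hM, hk] with a h1 h2
  rw [norm_smul]
  exact mul_le_mul h2 (h1 x (Metric.mem_closedBall_self zero_le_one)) (norm_nonneg _)
    ((norm_nonneg _).trans h2)

theorem hasFDerivAt_translateIntegral {f : ℂ → E} (hf : ContDiff ℝ 1 f) (hcm : Measurable c)
    (hkm : AEStronglyMeasurable k ν) (hc : ∀ᵐ a ∂ν, ‖c a‖ ≤ B) (hk : ∀ᵐ a ∂ν, ‖k a‖ ≤ C)
    (x : ℂ) : HasFDerivAt (translateIntegral ν c k f)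
      (translateIntegral ν c k (fderiv ℝ f) x) x := by
  have hf' : Continuous (fderiv ℝ f) := hf.continuous_fderiv one_ne_zero
  obtain ⟨M, hM0, hM⟩ := exists_bound_translate hf' hc x
  refine hasFDerivAt_integral_of_dominated_of_fderiv_le (𝕜 := ℝ)
    (F := fun x a => k a • f (x + c a)) (F' := fun x a => k a • fderiv ℝ f (x + c a))
    (bound := fun _ => C * M) (Metric.closedBall_mem_nhds x one_pos)
    (Eventually.of_forall fun y => aestronglyMeasurable_translate hf.continuous hcm hkm y)
    (integrable_translate hf.continuous hcm hkm hc hk x)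
    (aestronglyMeasurable_translate hf' hcm hkm x) ?_ (integrable_const _) ?_
  · filter_upwards [hM, hk] with a h1 h2 y hy
    rw [norm_smul]
    exact mul_le_mul h2 (h1 y hy) (norm_nonneg _) ((norm_nonneg _).trans h2)
  · refine Eventually.of_forall fun a y _ => ?_
    exact ((hasFDerivAt_comp_add_right (c a)).2
      ((hf.differentiable one_ne_zero) (y + c a)).hasFDerivAt).const_smul (k a)

end

variable [IsFiniteMeasure ν]

/-- The target space is quantified after `m` because the induction passes to `fderiv ℝ f`, whose
values are linear maps. -/
theorem contDiff_translateIntegral_nat (hcm : Measurable c)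
    (hkm : AEStronglyMeasurable k ν) (hc : ∀ᵐ a ∂ν, ‖c a‖ ≤ B) (hk : ∀ᵐ a ∂ν, ‖k a‖ ≤ C) (m : ℕ) :
    ∀ {E : Type} [NormedAddCommGroup E] [NormedSpace ℂ E] {f : ℂ → E}, ContDiff ℝ ∞ f →
      ContDiff ℝ m (translateIntegral ν c k f) := by
  induction m with
  | zero =>
    intro E _ _ f hf
    exact contDiff_zero.2 (continuous_iff_continuousAt.2 fun x =>
      (hasFDerivAt_translateIntegral (hf.of_le (by simp)) hcm hkm hc hk x).continuousAt)
  | succ m ih =>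
    intro E _ _ f hf
    have h := fun x => hasFDerivAt_translateIntegral (hf.of_le (by simp)) hcm hkm hc hk x
    push_cast
    rw [contDiff_succ_iff_fderiv]
    refine ⟨fun x => (h x).differentiableAt, by simp, ?_⟩
    rw [funext fun x => (h x).fderiv]
    exact ih (hf.fderiv_right (by simp))

theorem contDiff_translateIntegral (hcm : Measurable c) (hkm : AEStronglyMeasurable k ν)
    (hc : ∀ᵐ a ∂ν, ‖c a‖ ≤ B) (hk : ∀ᵐ a ∂ν, ‖k a‖ ≤ C) {f : ℂ → ℂ} (hf : ContDiff ℝ ∞ f) :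
    ContDiff ℝ ∞ (translateIntegral ν c k f) :=
  contDiff_infty.2 fun m => contDiff_translateIntegral_nat hcm hkm hc hk m hf

variable {f : ℂ → ℂ}

theorem fderiv_translateIntegral_apply (hcm : Measurable c) (hkm : AEStronglyMeasurable k ν)
    (hc : ∀ᵐ a ∂ν, ‖c a‖ ≤ B) (hk : ∀ᵐ a ∂ν, ‖k a‖ ≤ C) (hf : ContDiff ℝ ∞ f) (x v : ℂ) :
    fderiv ℝ (translateIntegral ν c k f) x v
      = translateIntegral ν c k (fun z => fderiv ℝ f z v) x := by
  have hf1 : ContDiff ℝ 1 f := hf.of_le (by simp)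
  rw [(hasFDerivAt_translateIntegral hf1 hcm hkm hc hk x).fderiv, translateIntegral,
    ContinuousLinearMap.integral_apply (integrable_translate (hf1.continuous_fderiv one_ne_zero)
      hcm hkm hc hk x)]
  rfl

theorem dbar_translateIntegral (hcm : Measurable c) (hkm : AEStronglyMeasurable k ν)
    (hc : ∀ᵐ a ∂ν, ‖c a‖ ≤ B) (hk : ∀ᵐ a ∂ν, ‖k a‖ ≤ C) (hf : ContDiff ℝ ∞ f) (x : ℂ) :
    dbar (translateIntegral ν c k f) x = translateIntegral ν c k (dbar f) x := by
  have hf1 : Continuous (fderiv ℝ f) := hf.continuous_fderiv (by simp)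
  have hi : ∀ v, Integrable (fun a => k a • fderiv ℝ f (x + c a) v) ν := fun v =>
    integrable_translate (f := fun z => fderiv ℝ f z v) (by fun_prop) hcm hkm hc hk x
  rw [dbar, fderiv_translateIntegral_apply hcm hkm hc hk hf,
    fderiv_translateIntegral_apply hcm hkm hc hk hf]
  simp only [translateIntegral]
  rw [← integral_const_mul, ← integral_add (hi 1) ((hi I).const_mul I)]
  refine integral_congr_ae (Eventually.of_forall fun a => ?_)
  simp only [dbar, smul_eq_mul]
  ring

theorem dz_translateIntegral (hcm : Measurable c) (hkm : AEStronglyMeasurable k ν)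
    (hc : ∀ᵐ a ∂ν, ‖c a‖ ≤ B) (hk : ∀ᵐ a ∂ν, ‖k a‖ ≤ C) (hf : ContDiff ℝ ∞ f) (x : ℂ) :
    dz (translateIntegral ν c k f) x = translateIntegral ν c k (dz f) x := by
  have hf1 : Continuous (fderiv ℝ f) := hf.continuous_fderiv (by simp)
  have hi : ∀ v, Integrable (fun a => k a • fderiv ℝ f (x + c a) v) ν := fun v =>
    integrable_translate (f := fun z => fderiv ℝ f z v) (by fun_prop) hcm hkm hc hk x
  rw [dz, fderiv_translateIntegral_apply hcm hkm hc hk hf,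
    fderiv_translateIntegral_apply hcm hkm hc hk hf]
  simp only [translateIntegral]
  rw [← integral_const_mul, ← integral_sub (hi 1) ((hi I).const_mul I)]
  refine integral_congr_ae (Eventually.of_forall fun a => ?_)
  simp only [dz, smul_eq_mul]
  ring

/-- Fubini. This carries vanishing over all circles of one radius from `f` to its superpositions. -/
theorem circleMoment_translateIntegral (hcm : Measurable c) (hkm : AEStronglyMeasurable k ν)
    (hc : ∀ᵐ a ∂ν, ‖c a‖ ≤ B) (hk : ∀ᵐ a ∂ν, ‖k a‖ ≤ C) (hf : Continuous f) (y : ℂ) (r : ℝ) :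
    circleMoment (translateIntegral ν c k f) y r
      = translateIntegral ν c k (fun x => circleMoment f x r) y := by
  have hint : Integrable (Function.uncurry fun (θ : ℝ) (a : α) =>
      k a • (f (circleMap y r θ + c a) * exp (θ * I)))
      ((volume.restrict (Ioc 0 (2 * π))).prod ν) := by
    obtain ⟨M, hM⟩ := (isCompact_closedBall y (|r| + B)).exists_bound_of_continuousOn
      hf.continuousOn
    have hcm' : Measurable fun p : ℝ × α => circleMap y r p.1 + c p.2 :=
      ((continuous_circleMap y r).measurable.comp measurable_fst).add (hcm.comp measurable_snd)
    refine Integrable.of_bound (C := C * M) ?_ ?_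
    · refine (hkm.comp_quasiMeasurePreserving Measure.quasiMeasurePreserving_snd).smul ?_
      refine (hf.comp_aestronglyMeasurable hcm'.aestronglyMeasurable).mul ?_
      exact (Continuous.aestronglyMeasurable (by fun_prop) :
        AEStronglyMeasurable (fun θ : ℝ => exp (θ * I)) _).comp_quasiMeasurePreserving
          Measure.quasiMeasurePreserving_fst
    · filter_upwards [Measure.quasiMeasurePreserving_snd.ae hc,
        Measure.quasiMeasurePreserving_snd.ae hk] with p h1 h2
      simp only [Function.uncurry]
      rw [norm_smul, norm_mul, norm_exp_ofReal_mul_I, mul_one]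
      refine mul_le_mul h2 (hM _ ?_) (norm_nonneg _) ((norm_nonneg _).trans h2)
      rw [mem_closedBall_iff_norm]
      calc ‖circleMap y r p.1 + c p.2 - y‖ = ‖(circleMap y r p.1 - y) + c p.2‖ := by ring_nf
        _ ≤ ‖circleMap y r p.1 - y‖ + ‖c p.2‖ := norm_add_le _ _
        _ ≤ |r| + B := add_le_add (by simp [circleMap]) h1
  simp only [circleMoment, translateIntegral, ← integral_mul_const]
  rw [intervalIntegral.integral_of_le (by positivity)]
  have hswap := integral_integral_swap hint
  refine Eq.trans ?_ (hswap.trans ?_)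
  · simp only [smul_eq_mul, mul_assoc]
  · refine integral_congr_ae (Eventually.of_forall fun a => ?_)
    simp only
    rw [integral_smul, intervalIntegral.integral_of_le (by positivity)]
    congr 2
    ext θ
    simp only [circleMap]
    ring_nf

end TranslateIntegral


/-! ### The smooth two-circle theorem -/

section SmoothTwoCircles

open Set Filter Topology Complex
open scoped ContDiff Real

variable {R C : ℝ} {χ : ℝ → ℝ} {f : ℂ → ℂ}

/-- The superposition of the contour integrals of `f` over the circles centred at `x` with squared
radius in `(0, R]`, with weight `χ`. -/
noncomputable def radialSuperposition (R : ℝ) (χ : ℝ → ℝ) : (ℂ → ℂ) → ℂ → ℂ :=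
  translateIntegral ((volume.restrict (Ioc 0 R)).prod (volume.restrict (Ioc 0 (2 * π))))
    (fun p : ℝ × ℝ => circleMap 0 √p.1 p.2) (fun p => exp (p.2 * I) * χ p.1)

theorem ae_prod_mem_Ioc (R : ℝ) : ∀ᵐ p : ℝ × ℝ
    ∂((volume.restrict (Ioc 0 R)).prod (volume.restrict (Ioc 0 (2 * π)))), p.1 ∈ Ioc 0 R :=
  Measure.quasiMeasurePreserving_fst.ae (ae_restrict_mem measurableSet_Ioc)

theorem measurable_circleMap_sqrt : Measurable fun p : ℝ × ℝ => circleMap 0 √p.1 p.2 := by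
  unfold circleMap
  fun_prop

theorem aestronglyMeasurable_weight (hχm : AEStronglyMeasurable χ (volume.restrict (Ioc 0 R))) :
    AEStronglyMeasurable (fun p : ℝ × ℝ => exp (p.2 * I) * (χ p.1 : ℂ))
      ((volume.restrict (Ioc 0 R)).prod (volume.restrict (Ioc 0 (2 * π)))) :=
  (Continuous.aestronglyMeasurable (by fun_prop)).mul (continuous_ofReal.comp_aestronglyMeasurable
    (hχm.comp_quasiMeasurePreserving Measure.quasiMeasurePreserving_fst))

theorem ae_norm_circleMap_le (R : ℝ) : ∀ᵐ p : ℝ × ℝ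
    ∂((volume.restrict (Ioc 0 R)).prod (volume.restrict (Ioc 0 (2 * π)))),
      ‖circleMap 0 √p.1 p.2‖ ≤ √R :=
  (ae_prod_mem_Ioc R).mono fun p hp => by
    rw [norm_circleMap_zero, abs_of_nonneg (Real.sqrt_nonneg _)]
    exact Real.sqrt_le_sqrt hp.2

theorem ae_norm_weight_le (hχ : ∀ t ∈ Ioc 0 R, |χ t| ≤ C) : ∀ᵐ p : ℝ × ℝ
    ∂((volume.restrict (Ioc 0 R)).prod (volume.restrict (Ioc 0 (2 * π)))),
      ‖exp (p.2 * I) * (χ p.1 : ℂ)‖ ≤ C :=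
  (ae_prod_mem_Ioc R).mono fun p hp => by
    rw [norm_mul, norm_exp_ofReal_mul_I, one_mul, norm_real]
    exact hχ _ hp

theorem radialSuperposition_eq (hχm : AEStronglyMeasurable χ (volume.restrict (Ioc 0 R)))
    (hχ : ∀ t ∈ Ioc 0 R, |χ t| ≤ C) (hf : Continuous f) (x : ℂ) :
    radialSuperposition R χ f x = ∫ t in Ioc 0 R, circleMoment f x √t * χ t := by
  rw [radialSuperposition, translateIntegral, integral_prod _ (integrable_translate hf
    measurable_circleMap_sqrt (aestronglyMeasurable_weight hχm) (ae_norm_circleMap_le R)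
    (ae_norm_weight_le hχ) x)]
  refine integral_congr_ae (Eventually.of_forall fun t => ?_)
  simp only
  rw [circleMoment, intervalIntegral.integral_of_le (by positivity), ← integral_mul_const]
  refine integral_congr_ae (Eventually.of_forall fun θ => ?_)
  simp only [circleMap, smul_eq_mul, zero_add]
  ring

theorem integrableOn_circleMoment_mul (hχm : AEStronglyMeasurable χ (volume.restrict (Ioc 0 R)))
    (hχ : ∀ t ∈ Ioc 0 R, |χ t| ≤ C) (hf : Continuous f) (x : ℂ) :
    IntegrableOn (fun t => circleMoment f x √t * χ t) (Ioc 0 R) := by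
  have h1 : Continuous fun t => circleMoment f x √t :=
    (continuous_circleMoment hf x).comp Real.continuous_sqrt
  have h2 : IntegrableOn (fun t => circleMoment f x √t) (Ioc 0 R) :=
    (h1.integrableOn_Icc (a := 0) (b := R)).mono_set Ioc_subset_Icc_self
  refine h2.mul_bdd (c := C) (continuous_ofReal.comp_aestronglyMeasurable hχm) ?_
  filter_upwards [ae_restrict_mem measurableSet_Ioc] with t ht
  rw [norm_real]
  exact hχ t ht

theorem IsStringSolution.aestronglyMeasurable_div_sqrt {μ : ℝ} {ψ : ℝ → ℝ} {p : ℝ → ℂ}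
    (hψ : IsStringSolution μ R (fun t => (ψ t : ℂ)) p) :
    AEStronglyMeasurable (fun t => ψ t / √t) (volume.restrict (Ioc 0 R)) := by
  refine ContinuousOn.aestronglyMeasurable ?_ measurableSet_Ioc
  have : ContinuousOn (fun t => (ψ t : ℂ).re) (Icc 0 R) :=
    continuous_re.comp_continuousOn hψ.continuousOn
  simp only [ofReal_re] at this
  exact (this.mono Ioc_subset_Icc_self).div Real.continuous_sqrt.continuousOn
    fun t ht => (Real.sqrt_pos.2 ht.1).ne'

/-- Green's formula for the Dirichlet problem on `(0, R)`. -/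
theorem radialSuperposition_dz_dbar (hf : ContDiff ℝ ∞ f) (hR : 0 < R) {μ : ℝ} {ψ p : ℝ → ℝ}
    (hψ : IsStringSolution μ R (fun t => (ψ t : ℂ)) (fun t => (p t : ℂ))) (hψR : ψ R = 0)
    (hC : ∀ t ∈ Ioc 0 R, |ψ t / √t| ≤ C) (x : ℂ) (hx : circleMoment f x √R = 0) :
    ∫ t in Ioc 0 R, circleMoment (dz (dbar f)) x √t * ((ψ t / √t : ℝ) : ℂ)
      = -(4 * μ) * ∫ t in Ioc 0 R, circleMoment f x √t * ((ψ t / √t : ℝ) : ℂ) := by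
  have hm : AEStronglyMeasurable (fun t => ψ t / √t) (volume.restrict (Ioc 0 R)) :=
    hψ.aestronglyMeasurable_div_sqrt
  have hL := (contDiff_dz (contDiff_dbar hf)).continuous
  have i1 := (integrableOn_circleMoment_mul hm hC hL x).const_mul (1 / 4)
  have i2 := (integrableOn_circleMoment_mul hm hC hf.continuous x).const_mul (μ : ℂ)
  -- The fundamental theorem for the Wronskian `Y'ψ - Yψ'`, which vanishes at both ends because `Y`
  -- and `ψ` do.
  have key := intervalIntegral.integral_eq_sub_of_hasDerivAt_of_le hR.le
    (f := fun t => sqContourDeriv f x t * ψ t - sqContour f x t * p t)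
    (f' := fun t => 1 / 4 * (circleMoment (dz (dbar f)) x √t * ((ψ t / √t : ℝ) : ℂ))
      + μ * (circleMoment f x √t * ((ψ t / √t : ℝ) : ℂ)))
    (((continuous_sqContourDeriv hf x).continuousOn.mul hψ.continuousOn).sub
      ((continuous_sqContour hf.continuous x).continuousOn.mul hψ.continuousOn_deriv))
    (fun t ht => by
      refine (((hasDerivAt_sqContourDeriv hf x ht.1).mul (hψ.hasDerivAt t ht)).sub
        ((hasDerivAt_sqContour hf x ht.1).mul (hψ.hasDerivAt_deriv t ht))).congr_deriv ?_
      have h1 : (√t : ℂ) ≠ 0 := ofReal_ne_zero.2 (Real.sqrt_pos.2 ht.1).ne'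
      have h2 : (t : ℂ) = √t * √t := by rw [← ofReal_mul, Real.mul_self_sqrt ht.1.le]
      rw [sqContour, h2]
      push_cast
      field_simp
      ring)
    ((intervalIntegrable_iff_integrableOn_Ioc_of_le hR.le).2 (i1.add i2))
  have h0 : ψ 0 = 0 := by exact_mod_cast hψ.map_zero
  rw [intervalIntegral.integral_of_le hR.le, integral_add i1 i2, integral_const_mul,
    integral_const_mul] at key
  simp only [hψR, h0, sqContour, hx, Real.sqrt_zero, ofReal_zero, mul_zero, zero_mul,
    sub_zero] at key
  linear_combination 4 * key

/-- The two-circle theorem for smooth functions. -/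
theorem dbar_eq_zero_of_circleMoment_eq_zero (hf : ContDiff ℝ ∞ f) {r₁ r₂ : ℝ} (hr₁ : 0 < r₁)
    (hr₂ : 0 < r₂) (h₁ : ∀ x, circleMoment f x r₁ = 0) (h₂ : ∀ x, circleMoment f x r₂ = 0)
    (hJ : ∀ l : ℝ, 0 < l → besselJ 1 (l * r₁) = 0 → besselJ 1 (l * r₂) ≠ 0) (x : ℂ) :
    dbar f x = 0 := by
  set R := r₁ ^ 2 with hRdef
  have hR : 0 < R := by positivity
  have hsR : √R = r₁ := Real.sqrt_sq hr₁.le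
  have hsS : √(r₂ ^ 2) = r₂ := Real.sqrt_sq hr₂.le
  have horth : ∀ (μ : ℝ) (ψ p : ℝ → ℝ), 0 < μ →
      IsStringSolution μ R (fun t => (ψ t : ℂ)) (fun t => (p t : ℂ)) → ψ R = 0 →
      (∃ C, ∀ t ∈ Ioc 0 R, |ψ t / √t| ≤ C) →
      ∫ t in Ioc 0 R, circleMoment f x √t * ((ψ t / √t : ℝ) : ℂ) = 0 := by
    rintro μ ψ p hμ hψ hψR ⟨C, hC⟩
    -- With zero slope at `0` the eigenfunction is identically zero; otherwise the slope may be
    -- cancelled below.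
    by_cases hp0 : p 0 = 0
    · rw [setIntegral_congr_fun measurableSet_Ioc (g := fun _ => 0) fun t ht => ?_]
      · simp
      have : (ψ t : ℂ) = 0 := hψ.eq_zero (by simp [hp0]) (Ioc_subset_Icc_self ht)
      simp [ofReal_eq_zero.1 this]
    set χ : ℝ → ℝ := fun t => ψ t / √t with hχdef
    have hχm : AEStronglyMeasurable χ (volume.restrict (Ioc 0 R)) :=
      hψ.aestronglyMeasurable_div_sqrt
    set w := radialSuperposition R χ f with hw
    have hkm := aestronglyMeasurable_weight hχm
    have hc := ae_norm_circleMap_le R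
    have hk := ae_norm_weight_le hC
    have hcm := measurable_circleMap_sqrt
    have hwsmooth : ContDiff ℝ ∞ w := contDiff_translateIntegral hcm hkm hc hk hf
    have hdbar : dbar w = radialSuperposition R χ (dbar f) :=
      funext (dbar_translateIntegral hcm hkm hc hk hf)
    have hlap : ∀ z, dz (dbar w) z = -(4 * μ) * w z := fun z => by
      rw [hdbar, hw, radialSuperposition_eq hχm hC hf.continuous, radialSuperposition,
        dz_translateIntegral hcm hkm hc hk (contDiff_dbar hf), ← radialSuperposition,
        radialSuperposition_eq hχm hC (contDiff_dz (contDiff_dbar hf)).continuous]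
      exact radialSuperposition_dz_dbar hf hR hψ hψR hC z (by rw [hsR, h₁])
    have hw2 : ∀ y, circleMoment w y r₂ = 0 := fun y => by
      rw [hw, radialSuperposition, circleMoment_translateIntegral hcm hkm hc hk hf.continuous,
        translateIntegral]
      simp [h₂]
    -- The frequency for which the plane wave has the same eigenvalue `-4μ` of the Laplacian as `w`.
    set l := 2 * √μ with hl
    have hl0 : 0 < l := by positivity
    have hlμ : l ^ 2 / 4 = μ := by
      rw [hl, mul_pow, Real.sq_sqrt hμ.le]
      ring
    set b : ℂ → ℂ := fun z => exp (-(l * z.im) * I) with hb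
    have hbS : ∀ S, IsStringSolution μ S (sqContour b 0) (sqContourDeriv b 0) := fun S =>
      isStringSolution_sqContour (contDiff_planeWave l)
        (fun z => by rw [dz_dbar_planeWave, hlμ]) 0 S
    have hbd : sqContourDeriv b 0 0 ≠ 0 := by
      rw [sqContourDeriv_zero, hb, dbar_planeWave]
      simp [hl0.ne', Real.pi_ne_zero]
    have hJ1 : besselJ 1 (l * r₁) = 0 := by
      have h := (hψ.mul_eq_mul (hbS R) (right_mem_Icc.2 hR.le)).symm
      rw [hψR, sqContour, hsR, hb, circleMoment_planeWave] at h
      simpa [hp0, hr₁.ne', Real.pi_ne_zero] using h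
    have hJ2 := hJ l hl0 hJ1
    -- The slope at `0` about `y` is `π * dbar w y`, so proportionality to the Bessel solution at `t
    -- = r₂²` gives `dbar w y * J₁(l r₂) = 0`.
    have hdw : ∀ y, dbar w y = 0 := fun y => by
      have h := ((isStringSolution_sqContour hwsmooth hlap y (r₂ ^ 2)).mul_eq_mul (hbS (r₂ ^ 2))
        (right_mem_Icc.2 (by positivity))).symm
      rw [sqContour, sqContour, hsS, hw2, hb, circleMoment_planeWave, sqContourDeriv_zero] at h
      simpa [hJ2, hr₂.ne', Real.pi_ne_zero] using h
    have hw0 : w x = 0 := by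
      have h := hlap x
      rw [funext hdw, dz] at h
      simpa [hμ.ne'] using h
    rwa [hw, radialSuperposition_eq hχm hC hf.continuous] at hw0
  have hcont : Continuous fun t => circleMoment f x √t :=
    (continuous_circleMoment hf.continuous x).comp Real.continuous_sqrt
  have hzero : ∀ t ∈ Ioo 0 R, circleMoment f x √t = 0 := by
    -- Completeness was proved for real functions, so it is applied to real and imaginary parts.
    have aux : ∀ L : ℂ →L[ℝ] ℝ, ∀ t ∈ Ioo 0 R, L (circleMoment f x √t) = 0 := fun L => by
      refine eq_zero_of_orthogonal_eigenfunctions hR (L.continuous.comp hcont).continuousOn ?_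
      rintro μ ψ p hμ hψ hψR ⟨C, hC⟩
      have hm : AEStronglyMeasurable (fun t => ψ t / √t) (volume.restrict (Ioc 0 R)) :=
        hψ.aestronglyMeasurable_div_sqrt
      have h := L.integral_comp_comm (integrableOn_circleMoment_mul hm hC hf.continuous x)
      rw [horth μ ψ p hμ hψ hψR ⟨C, hC⟩, map_zero] at h
      refine Eq.trans (integral_congr_ae (Eventually.of_forall fun t => ?_)) h
      simp only
      rw [mul_comm (circleMoment f x √t), ← real_smul, map_smul, smul_eq_mul, mul_comm]
    exact fun t ht => Complex.ext (aux reCLM t ht) (aux imCLM t ht)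
  have hderiv : EqOn (sqContourDeriv f x) 0 (Ioo 0 R) := fun t ht => by
    have h0 : EqOn (sqContour f x) 0 (Ioo 0 R) := fun s hs => by simp [sqContour, hzero s hs]
    exact (hasDerivAt_sqContour hf x ht.1).unique ((hasDerivAt_const t (0 : ℂ)).congr_of_eventuallyEq
      (h0.eventuallyEq_of_mem (isOpen_Ioo.mem_nhds ht)))
  have h0 : sqContourDeriv f x 0 = 0 := by
    have := hderiv.closure (continuous_sqContourDeriv hf x) continuous_const
    rw [closure_Ioo hR.ne] at this
    exact this (left_mem_Icc.2 hR.le)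
  rw [sqContourDeriv_zero] at h0
  simpa [Real.pi_ne_zero] using h0

end SmoothTwoCircles


/-! ### Passage between locally integrable and smooth functions -/

section Mollification

open Set Filter Topology Complex
open scoped ContDiff Real Convolution

variable {f : ℂ → ℂ} {g : ℂ → ℝ}

theorem convolution_lsmul_apply (g : ℂ → ℝ) (f : ℂ → ℂ) (x : ℂ) :
    (g ⋆[ContinuousLinearMap.lsmul ℝ ℝ, volume] f) x = ∫ y, (g y : ℂ) * f (x - y) := by
  simp [convolution_def]

section Swap

variable {A : Type*} [MeasurableSpace A] {μ : Measure A} [IsFiniteMeasure μ] {c k : A → ℂ}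
  {B C : ℝ}

/-- After the shear `y ↦ c a - y` the argument of `f` no longer depends on `a`. As `g` has compact
support and `c` is essentially bounded, `f` may be cut off to a ball, where it is integrable. -/
theorem integrable_prod_translate (hf : LocallyIntegrable f volume) (hg : Continuous g)
    (hgs : HasCompactSupport g) (hcm : Measurable c) (hc : ∀ᵐ a ∂μ, ‖c a‖ ≤ B)
    (hkm : AEStronglyMeasurable k μ) (hk : ∀ᵐ a ∂μ, ‖k a‖ ≤ C) :
    Integrable (fun p : A × ℂ => k p.1 * ((g p.2 : ℂ) * f (c p.1 - p.2))) (μ.prod volume) := by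
  obtain ⟨D, hD⟩ := hgs.isCompact.isBounded.subset_closedBall (0 : ℂ)
  obtain ⟨M, hM⟩ := hg.bounded_above_of_compact_support hgs
  set K := Metric.closedBall (0 : ℂ) (B + D) with hK
  have hfK : Integrable (K.indicator f) volume :=
    (integrable_indicator_iff measurableSet_closedBall).2
      (hf.integrableOn_isCompact (isCompact_closedBall _ _))
  have hcm' : Measurable fun p : A × ℂ => c p.1 - p.2 :=
    (hcm.comp measurable_fst).sub measurable_snd
  have h1 : Integrable (fun p : A × ℂ => (k p.1 * (g (c p.1 - p.2) : ℂ)) * K.indicator f p.2)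
      (μ.prod volume) := by
    refine (hfK.comp_snd μ).bdd_mul (c := C * M) ?_ ?_
    · exact (hkm.comp_quasiMeasurePreserving Measure.quasiMeasurePreserving_fst).mul
        ((continuous_ofReal.comp hg).comp_aestronglyMeasurable hcm'.aestronglyMeasurable)
    · filter_upwards [Measure.quasiMeasurePreserving_fst.ae hk] with p hp
      rw [norm_mul, norm_real]
      exact mul_le_mul hp (hM _) (norm_nonneg _) ((norm_nonneg _).trans hp)
  have h2 : Integrable (fun p : A × ℂ => k p.1 * ((g (c p.1 - p.2) : ℂ) * f p.2))
      (μ.prod volume) := by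
    refine h1.congr ?_
    filter_upwards [Measure.quasiMeasurePreserving_fst.ae hc] with p hp
    rw [mul_assoc]
    by_cases hpK : p.2 ∈ K
    · rw [indicator_of_mem hpK]
    · have : g (c p.1 - p.2) = 0 := by
        by_contra hne
        have h3 := hD (subset_tsupport g hne)
        rw [mem_closedBall_zero_iff] at h3
        refine hpK ?_
        rw [hK, mem_closedBall_zero_iff]
        calc ‖p.2‖ = ‖c p.1 - (c p.1 - p.2)‖ := by rw [sub_sub_cancel]
          _ ≤ ‖c p.1‖ + ‖c p.1 - p.2‖ := norm_sub_le _ _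
          _ ≤ B + D := add_le_add hp h3
      simp [this]
  have hΦ : MeasurePreserving (fun p : A × ℂ => (p.1, c p.1 - p.2)) (μ.prod volume)
      (μ.prod volume) :=
    (MeasurePreserving.id μ).skew_product (g := fun a y => c a - y) hcm'
      (Eventually.of_forall fun a => (Measure.measurePreserving_sub_left volume (c a)).map_eq)
  refine ((hΦ.integrable_comp h2.1).2 h2).congr (Eventually.of_forall fun p => ?_)
  simp

theorem integral_mul_convolution (hf : LocallyIntegrable f volume) (hg : Continuous g)
    (hgs : HasCompactSupport g) (hcm : Measurable c) (hc : ∀ᵐ a ∂μ, ‖c a‖ ≤ B)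
    (hkm : AEStronglyMeasurable k μ) (hk : ∀ᵐ a ∂μ, ‖k a‖ ≤ C) :
    ∫ a, k a * (g ⋆[ContinuousLinearMap.lsmul ℝ ℝ, volume] f) (c a) ∂μ
      = ∫ y, (g y : ℂ) * ∫ a, k a * f (c a - y) ∂μ := by
  simp only [convolution_lsmul_apply, ← integral_const_mul]
  rw [integral_integral_swap (integrable_prod_translate hf hg hgs hcm hc hkm hk)]
  simp only [mul_left_comm]

end Swap

/-- Rotating the disc about its centre only shifts the angle in the parametrization, so the contour
integral depends on the translation alone; Fubini supplies one good angle. -/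
theorem ae_circleMoment_eq_zero {r : ℝ} (hr : r ≠ 0) (h : ContourIntegralsVanish f r) :
    ∀ᵐ b : ℂ, circleMoment f b r = 0 := by
  obtain ⟨α, hα⟩ := (Measure.ae_ae_of_ae_prod h).exists
  filter_upwards [hα] with b hb
  set G : ℝ → ℂ := fun θ => f (circleMap b r θ) * exp (θ * I) with hG
  have hper : Function.Periodic G (2 * π) := fun θ => by
    simp only [hG, periodic_circleMap b r θ]
    congr 1
    push_cast
    rw [add_mul, exp_add, exp_two_pi_mul_I, mul_one]
  have h1 : contourIntegral f (rigidMotion α b) r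
      = ∫ θ in (0 : ℝ)..(2 * π), r * I * G (θ + α) := by
    refine intervalIntegral.integral_congr fun θ _ => ?_
    have hd : HasDerivAt (fun t : ℝ => rigidMotion α b (circleMap 0 r t))
        (exp (α * I) * (circleMap 0 r θ * I)) θ :=
      ((hasDerivAt_circleMap 0 r θ).const_mul _).add_const b
    have hm : rigidMotion α b (circleMap 0 r θ) = circleMap b r (θ + α) := by
      simp only [rigidMotion, circleMap]
      push_cast
      rw [add_mul, exp_add]
      ring
    simp only [hd.deriv, hm, hG]
    simp only [circleMap]
    push_cast
    rw [add_mul, exp_add]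
    ring
  rw [h1, intervalIntegral.integral_const_mul, intervalIntegral.integral_comp_add_right G α,
    zero_add, add_comm (2 * π) α, hper.intervalIntegral_add_eq α 0, zero_add] at hb
  exact (mul_eq_zero.1 hb).resolve_left (mul_ne_zero (ofReal_ne_zero.2 hr) I_ne_zero)

/-- The moment of the convolution about `x` averages the moments of `f` about `x - y`, which vanish
for almost every `y`. Hence the exceptional set of centres disappears. -/
theorem circleMoment_convolution_eq_zero (hf : LocallyIntegrable f volume) (hg : Continuous g)
    (hgs : HasCompactSupport g) {r : ℝ} (hr : r ≠ 0) (h : ContourIntegralsVanish f r) (x : ℂ) :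
    circleMoment (g ⋆[ContinuousLinearMap.lsmul ℝ ℝ, volume] f) x r = 0 := by
  have h0 := (Measure.measurePreserving_sub_left volume x).quasiMeasurePreserving.ae
    (ae_circleMoment_eq_zero hr h)
  have h1 := integral_mul_convolution (μ := volume.restrict (Ioc 0 (2 * π)))
    (c := circleMap x r) (k := fun θ => exp (θ * I)) (B := ‖x‖ + |r|) (C := 1) hf hg hgs
    (continuous_circleMap x r).measurable
    (Eventually.of_forall fun θ => by
      refine (norm_add_le _ _).trans ?_
      simp)
    (Continuous.aestronglyMeasurable (by fun_prop))
    (Eventually.of_forall fun θ => by rw [norm_exp_ofReal_mul_I])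
  rw [circleMoment, intervalIntegral.integral_of_le (by positivity)]
  simp only [mul_comm _ (exp _)]
  rw [h1, ← integral_zero ℂ ℂ]
  refine integral_congr_ae ?_
  filter_upwards [h0] with y hy
  rw [circleMoment, intervalIntegral.integral_of_le (by positivity)] at hy
  have : ∀ θ : ℝ, exp (θ * I) * f (circleMap x r θ - y)
      = f (circleMap (x - y) r θ) * exp (θ * I) := fun θ => by
    rw [mul_comm]
    simp only [circleMap]
    ring_nf
  simp only [this, hy, mul_zero]

theorem convolution_convolution_comm {ρ : ℂ → ℝ} (hf : LocallyIntegrable f volume)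
    (hg : Continuous g) (hgs : HasCompactSupport g) (hρ : Continuous ρ)
    (hρs : HasCompactSupport ρ) (x : ℂ) :
    (ρ ⋆[ContinuousLinearMap.lsmul ℝ ℝ, volume]
      (g ⋆[ContinuousLinearMap.lsmul ℝ ℝ, volume] f)) x
    = (g ⋆[ContinuousLinearMap.lsmul ℝ ℝ, volume]
      (ρ ⋆[ContinuousLinearMap.lsmul ℝ ℝ, volume] f)) x := by
  obtain ⟨D, hD⟩ := hρs.isCompact.isBounded.subset_closedBall (0 : ℂ)
  obtain ⟨M, hM⟩ := hρ.bounded_above_of_compact_support hρs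
  -- Restricting to a ball containing the support of `ρ` provides the finite measure needed for the
  -- interchange.
  have hres : ∀ F : ℂ → ℂ, ∫ a in Metric.closedBall 0 D, (ρ a : ℂ) * F a = ∫ a, (ρ a : ℂ) * F a :=
    fun F => setIntegral_eq_integral_of_forall_compl_eq_zero fun a ha => by
      have : ρ a = 0 := by
        by_contra hne
        exact ha (hD (subset_tsupport ρ hne))
      simp [this]
  have : IsFiniteMeasure (volume.restrict (Metric.closedBall (0 : ℂ) D)) :=
    ⟨by
    rw [Measure.restrict_apply_univ]
    exact (isCompact_closedBall _ _).measure_lt_top⟩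
  have h1 := integral_mul_convolution (μ := volume.restrict (Metric.closedBall (0 : ℂ) D))
    (c := fun a => x - a) (k := fun a => (ρ a : ℂ)) (B := ‖x‖ + D) (C := M) hf hg hgs
    (by fun_prop)
    (by
      filter_upwards [ae_restrict_mem measurableSet_closedBall] with a ha
      rw [mem_closedBall_zero_iff] at ha
      exact (norm_sub_le _ _).trans (by gcongr))
    (Continuous.aestronglyMeasurable (by fun_prop))
    (Eventually.of_forall fun a => by rw [norm_real]; exact hM a)
  simp only [hres] at h1
  rw [convolution_lsmul_apply, h1, convolution_lsmul_apply]
  simp only [convolution_lsmul_apply, sub_right_comm]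

/-- A smooth radial bump function supported in the unit disc. -/
noncomputable def radialBump (z : ℂ) : ℝ := Real.smoothTransition (1 - ‖z‖ ^ 2)

theorem contDiff_radialBump : ContDiff ℝ ∞ radialBump :=
  Real.smoothTransition.contDiff.comp (contDiff_const.sub (contDiff_norm_sq ℝ))

theorem radialBump_eq_zero {z : ℂ} (hz : 1 ≤ ‖z‖) : radialBump z = 0 :=
  Real.smoothTransition.zero_of_nonpos (sub_nonpos.2 (one_le_pow₀ hz))

theorem hasCompactSupport_radialBump : HasCompactSupport radialBump :=
  HasCompactSupport.intro (isCompact_closedBall 0 1) fun z hz =>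
    radialBump_eq_zero (by rw [mem_closedBall_zero_iff, not_le] at hz; exact hz.le)

theorem integral_radialBump_pos : 0 < ∫ z, radialBump z := by
  refine contDiff_radialBump.continuous.integral_pos_of_hasCompactSupport_nonneg_nonzero
    hasCompactSupport_radialBump (fun z => Real.smoothTransition.nonneg _) (x := 0) ?_
  simp [radialBump]

/-- The mean value property on the unit circle for the entire function `ζ ↦ h (x - ζ y)`. -/
theorem integral_comp_circle_of_differentiable {h : ℂ → ℂ} (hh : Differentiable ℂ h) (x y : ℂ) :
    ∫ θ in (0 : ℝ)..(2 * π), h (x - exp (θ * I) * y) = 2 * π * h x := by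
  have hk : Differentiable ℂ fun ζ : ℂ => h (x - ζ * y) := by fun_prop
  have h1 := hk.diffContOnCl.circleAverage (c := 0) (R := 1)
  rw [Real.circleAverage] at h1
  simp only [circleMap, ofReal_one, one_mul, zero_add, zero_mul, sub_zero, real_smul] at h1
  have : (π : ℂ) ≠ 0 := ofReal_ne_zero.2 Real.pi_ne_zero
  rw [← h1, ← mul_assoc]
  push_cast
  rw [mul_inv_cancel₀ (by simp), one_mul]

/-- The mean value property of entire functions for a radial weight. -/
theorem radialBump_convolution_of_differentiable {h : ℂ → ℂ} (hh : Differentiable ℂ h) (x : ℂ) :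
    (radialBump ⋆[ContinuousLinearMap.lsmul ℝ ℝ, volume] h) x
      = (∫ z, radialBump z : ℝ) * h x := by
  rw [convolution_lsmul_apply]
  have hc := hh.continuous
  have hρ := contDiff_radialBump.continuous
  -- Radial symmetry lets the integral be averaged over all rotations of `y`.
  have hrot : ∀ θ : ℝ, ∫ y, (radialBump y : ℂ) * h (x - exp (θ * I) * y)
      = ∫ y, (radialBump y : ℂ) * h (x - y) := fun θ => by
    have h1 := (rotation (Circle.exp θ)).measurePreserving.integral_comp
      (rotation (Circle.exp θ)).toHomeomorph.measurableEmbedding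
      (fun y => (radialBump y : ℂ) * h (x - y))
    rw [← h1]
    refine integral_congr_ae (Eventually.of_forall fun y => ?_)
    simp [radialBump, rotation_apply, Circle.coe_exp]
  obtain ⟨M, hM⟩ := (isCompact_closedBall x 1).exists_bound_of_continuousOn hc.continuousOn
  have hint : Integrable (Function.uncurry fun (θ : ℝ) (y : ℂ) =>
      (radialBump y : ℂ) * h (x - exp (θ * I) * y))
      ((volume.restrict (Ioc 0 (2 * π))).prod volume) := by
    have h1 : Integrable (fun y => M * radialBump y) volume :=
      (hρ.integrable_of_hasCompactSupport hasCompactSupport_radialBump).const_mul M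
    refine (h1.comp_snd (volume.restrict (Ioc 0 (2 * π)))).mono'
      (Continuous.aestronglyMeasurable (by unfold Function.uncurry; fun_prop))
      (Eventually.of_forall fun p => ?_)
    simp only [Function.uncurry]
    have h0 : 0 ≤ radialBump p.2 := Real.smoothTransition.nonneg _
    rw [norm_mul, norm_real, Real.norm_of_nonneg h0, mul_comm]
    by_cases hp : 1 ≤ ‖p.2‖
    · simp [radialBump_eq_zero hp]
    · refine mul_le_mul_of_nonneg_right (hM _ ?_) h0
      rw [mem_closedBall_iff_norm, sub_sub_cancel_left, norm_neg, norm_mul,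
        norm_exp_ofReal_mul_I, one_mul]
      exact (not_le.1 hp).le
  have h2 := integral_integral_swap hint
  simp only [hrot, integral_const_mul] at h2
  simp only [← intervalIntegral.integral_of_le (show (0 : ℝ) ≤ 2 * π by positivity),
    integral_comp_circle_of_differentiable hh] at h2
  rw [intervalIntegral.integral_const, integral_mul_const, integral_complex_ofReal, sub_zero,
    real_smul] at h2
  have h3 : ((2 * π : ℝ) : ℂ) ≠ 0 := ofReal_ne_zero.2 (by positivity)
  refine mul_left_cancel₀ h3 (h2.trans ?_)
  push_cast
  ring

/-- A locally integrable function all of whose mollifications are entire is almost everywhere equal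
to an entire function. -/
theorem exists_entire_of_convolution (hf : LocallyIntegrable f volume)
    (h : ∀ g : ℂ → ℝ, ContDiff ℝ ∞ g → HasCompactSupport g →
      Differentiable ℂ (g ⋆[ContinuousLinearMap.lsmul ℝ ℝ, volume] f)) :
    ∃ F : ℂ → ℂ, Differentiable ℂ F ∧ f =ᵐ[volume] F := by
  set κ : ℂ := ((∫ z, radialBump z : ℝ) : ℂ) with hκ
  have hκ0 : κ ≠ 0 := ofReal_ne_zero.2 integral_radialBump_pos.ne'
  have hG := h radialBump contDiff_radialBump hasCompactSupport_radialBump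
  refine ⟨fun z => κ⁻¹ * (radialBump ⋆[ContinuousLinearMap.lsmul ℝ ℝ, volume] f) z,
    hG.const_mul _, ?_⟩
  -- The outer radius is twice the inner one: almost everywhere convergence needs a bounded ratio,
  -- here `K = 2`.
  let φ : ℕ → ContDiffBump (0 : ℂ) := fun n =>
    ⟨1 / ((n : ℝ) + 1), 2 * (1 / ((n : ℝ) + 1)), by positivity, by
      have : 0 < 1 / ((n : ℝ) + 1) := by positivity
      linarith⟩
  have hφ : Tendsto (fun n => (φ n).rOut) atTop (𝓝 0) := by
    simpa [φ] using (tendsto_one_div_add_atTop_nhds_zero_nat (𝕜 := ℝ)).const_mul 2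
  filter_upwards [ContDiffBump.ae_convolution_tendsto_right_of_locallyIntegrable (K := 2) hφ
    (Eventually.of_forall fun n => le_rfl) hf] with x hx
  have h1 := ContDiffBump.convolution_tendsto_right_of_continuous (μ := volume) hφ
    hG.continuous x
  have h2 : ∀ n, ((φ n).normed volume ⋆[ContinuousLinearMap.lsmul ℝ ℝ, volume]
      (radialBump ⋆[ContinuousLinearMap.lsmul ℝ ℝ, volume] f)) x
      = κ * ((φ n).normed volume ⋆[ContinuousLinearMap.lsmul ℝ ℝ, volume] f) x := fun n => by
    rw [← convolution_convolution_comm hf (φ n).continuous_normed (φ n).hasCompactSupport_normed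
      contDiff_radialBump.continuous hasCompactSupport_radialBump]
    exact radialBump_convolution_of_differentiable
      (h _ (φ n).contDiff_normed (φ n).hasCompactSupport_normed) x
  simp only [h2] at h1
  -- The same sequence tends to `κ f(x)` by Lebesgue differentiation and to `(ρ ⋆ f)(x)` by
  -- continuity.
  rw [← tendsto_nhds_unique (hx.const_mul κ) h1]
  field_simp

end Mollification

/-! ### The two-circle theorem for locally integrable functions -/

theorem mainTheorem5 (f : ℂ → ℂ) (hf : LocallyIntegrable f volume)
    (r₁ r₂ : ℝ) (hr₁ : 0 < r₁) (hr₂ : 0 < r₂)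
    (h₁ : ContourIntegralsVanish f r₁) (h₂ : ContourIntegralsVanish f r₂)
    (hr : ∀ s t : ℝ, 0 < s → 0 < t → besselJ 1 s = 0 → besselJ 1 t = 0 → r₁ / r₂ ≠ s / t) :
    ∃ F : ℂ → ℂ, Differentiable ℂ F ∧ f =ᵐ[volume] F := by
  refine exists_entire_of_convolution hf fun g hg hgs => ?_
  have hsmooth := hgs.contDiff_convolution_left (ContinuousLinearMap.lsmul ℝ ℝ) hg hf
  refine differentiable_of_dbar_eq_zero hsmooth
    (dbar_eq_zero_of_circleMoment_eq_zero hsmooth hr₁ hr₂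
      (circleMoment_convolution_eq_zero hf hg.continuous hgs hr₁.ne' h₁)
      (circleMoment_convolution_eq_zero hf hg.continuous hgs hr₂.ne' h₂) fun l hl hJ₁ hJ₂ => ?_)
  -- A common frequency `l` would exhibit `r₁ / r₂` as the excluded quotient of zeros.
  refine hr (l * r₁) (l * r₂) (by positivity) (by positivity) hJ₁ hJ₂ ?_
  field_simp
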